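/- Let $k$ be a field of prime characteristic $p>0$ and let $R=\bigoplus_{n\ge 0}R_n$ be an $\mathbb{N}$-graded Noetherian $k$-algebra with $R_0=k$ and homogeneous maximal ideal $\mathfrak m=\bigoplus_{n>0}R_n$. Compute the $\mathbb Z$-graded local cohomology modules $H^i_{\mathfrak m}(R)$, with their Frobenius action $F$ induced by the $p$-th power map, by the Čech complex on homogeneous elements $x_1,\dots,x_s$ with $\sqrt{(x_1,\dots,x_s)}=\mathfrak m$. Assume: (i) there is an integer $n_0\in\mathbb N$ such that for every $i$ and every $m\ge n_0$ the Frobenius action $F:[H^i_{\mathfrak m}(R)]_{-m}\to[H^i_{\mathfrak m}(R)]_{-mp}$ is injective; (ii) for every $i$ the Frobenius action $F:[H^i_{\mathfrak m}(R)]_0\to[H^i_{\mathfrak m}(R)]_0$ is injective; (iii) there are an integer $j\in\mathbb N$, a $k$-subspace $V\subseteq[H^j_{\mathfrak m}(R)]_0$ with $F(V)\subseteq V$, and an element $\eta\in[H^j_{\mathfrak m}(R)]_0$ with $\eta\notin V$ and $F(\eta)\in V$. Let $n\ge n_0$ be a positive integer such that $[H^i_{\mathfrak m}(R)]_{tn}=0$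 for all $i$ and all integers $t\ge 1$ (for example, any positive $n\ge n_0$ larger than every degree in which some $H^i_{\mathfrak m}(R)$ is nonzero; for Cohen–Macaulay $R$ this means $n>a(R)$). Let $T=R^{(n)}=\bigoplus_{t\ge 0}R_{nt}$ be the $n$-th Veronese subring, with homogeneous maximal ideal $\mathfrak n=\bigoplus_{t>0}R_{nt}$. Then the local ring $T_{\mathfrak n}$ is $F$-injective but not $F$-anti-nilpotent. Here a Noetherian local ring $(A,\mathfrak a)$ of characteristic $p$ is *$F$-injective* if the Frobenius action on $H^i_{\mathfrak a}(A)$ is injective for all $i\le\dim A$, and *$F$-anti-nilpotent* if for all $i\le\dim A$ and all $A$-submodules $N\subseteq H^i_{\mathfrak a}(A)$ with $F(N)\subseteq N$ the induced Frobenius action on $H^i_{\mathfrak a}(A)/N$ is injective. -/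

import Mathlib

noncomputable section

/-! ### The Čech complex of a finite sequence of elements -/

section Cech

variable {A : Type*} [CommRing A] {s : ℕ} (x : Fin s → A)

/-- The localization `A_{x_I}` of `A` at the element `x_I = ∏_{j ∈ I} x_j`. -/
abbrev CechLoc (I : Finset (Fin s)) : Type _ :=
  Localization.Away (∏ j ∈ I, x j)

theorem isUnit_cechLoc {I J : Finset (Fin s)} (h : I ⊆ J) :
    IsUnit (algebraMap A (CechLoc x J) (∏ j ∈ I, x j)) :=
  isUnit_of_dvd_unit (map_dvd _ (Finset.prod_dvd_prod_of_subset I J x h))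
    (IsLocalization.Away.algebraMap_isUnit (S := CechLoc x J) (∏ j ∈ J, x j))

/-- The canonical map of `A`-algebras `A_{x_I} → A_{x_J}` for `I ⊆ J`. -/
def cechRes {I J : Finset (Fin s)} (h : I ⊆ J) : CechLoc x I →ₐ[A] CechLoc x J :=
  { IsLocalization.Away.lift (S := CechLoc x I) (∏ j ∈ I, x j)
      (g := algebraMap A (CechLoc x J)) (isUnit_cechLoc x h) with
    commutes' := fun a => IsLocalization.Away.lift_eq _ (isUnit_cechLoc x h) a }

/-- The `i`-th term `⨁_{|I| = i} A_{x_I}` of the Čech complex. -/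
abbrev CechCochain (i : ℕ) : Type _ :=
  (I : {I : Finset (Fin s) // I.card = i}) → CechLoc x I.1

/-- The index set `J ∖ {a}`, for `a ∈ J`. -/
def cechFace {i : ℕ} (J : {J : Finset (Fin s) // J.card = i + 1}) (a : J.1) :
    {I : Finset (Fin s) // I.card = i} :=
  ⟨J.1.erase a.1, by rw [Finset.card_erase_of_mem a.2, J.2, Nat.add_sub_cancel]⟩

theorem cechFace_subset {i : ℕ} (J : {J : Finset (Fin s) // J.card = i + 1}) (a : J.1) :
    (cechFace J a).1 ⊆ J.1 :=
  Finset.erase_subset _ _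

/-- The sign `(-1)^{#{b ∈ J, b < a}}`. -/
def cechSign (J : Finset (Fin s)) (a : Fin s) : ℤ :=
  (-1) ^ (J.filter (· < a)).card

/-- The Čech differential
`(d c)_J = ∑_{a ∈ J} (-1)^{#{b ∈ J, b < a}} c_{J ∖ {a}}|_{A_{x_J}}`. -/
def cechD (i : ℕ) : CechCochain x i →ₗ[A] CechCochain x (i + 1) where
  toFun c J := ∑ a : J.1, cechSign J.1 a.1 • cechRes x (cechFace_subset J a) (c (cechFace J a))
  map_add' c c' := by
    funext J
    simp only [Pi.add_apply, map_add, smul_add, Finset.sum_add_distrib]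
  map_smul' r c := by
    funext J
    simp only [Pi.smul_apply, map_smul, Finset.smul_sum, RingHom.id_apply]
    exact Finset.sum_congr rfl fun a _ => smul_comm _ _ _

theorem cechD_apply (i : ℕ) (c : CechCochain x i)
    (J : {J : Finset (Fin s) // J.card = i + 1}) :
    cechD x i c J = ∑ a : J.1, cechSign J.1 a.1 •
      cechRes x (cechFace_subset J a) (c (cechFace J a)) := rfl

theorem cechRes_cechRes {I J K : Finset (Fin s)} (h : I ⊆ J) (h' : J ⊆ K) (z : CechLoc x I) :
    cechRes x h' (cechRes x h z) = cechRes x (h.trans h') z := by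
  have : (cechRes x h').comp (cechRes x h) = cechRes x (h.trans h') :=
    IsLocalization.algHom_ext (Submonoid.powers (∏ j ∈ I, x j)) (by ext)
  exact DFunLike.congr_fun this z

theorem cechSign_antisymm {J : Finset (Fin s)} {a b : Fin s} (ha : a ∈ J)
    (hab : a < b) :
    cechSign J a * cechSign (J.erase a) b = - (cechSign J b * cechSign (J.erase b) a) := by
  have h1 : (J.erase b).filter (· < a) = J.filter (· < a) := by
    ext c; simp only [Finset.mem_filter, Finset.mem_erase]
    constructor
    · tauto
    · rintro ⟨h, h'⟩; exact ⟨⟨(h'.trans hab).ne, h⟩, h'⟩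
  have h2 : (J.erase a).filter (· < b) = (J.filter (· < b)).erase a := by
    ext c; simp only [Finset.mem_filter, Finset.mem_erase]; tauto
  have h3 : a ∈ J.filter (· < b) := by simp [ha, hab]
  have h4 : (J.filter (· < b)).card = ((J.filter (· < b)).erase a).card + 1 :=
    (Finset.card_erase_add_one h3).symm
  rw [cechSign, cechSign, cechSign, cechSign, h1, h2, h4]
  ring

/-- The Čech differentials compose to zero. -/
theorem cechD_comp_cechD (i : ℕ) (c : CechCochain x i) : cechD x (i + 1) (cechD x i c) = 0 := by
  funext J
  have hcongr : ∀ (I I' : {I : Finset (Fin s) // I.card = i}) (_ : I = I')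
      (h : I.1 ⊆ J.1) (h' : I'.1 ⊆ J.1), cechRes x h (c I) = cechRes x h' (c I') := by
    rintro I _ rfl _ _; rfl
  have hanti : ∀ {a b : Fin s}, a ∈ J.1 → b ∈ J.1 → a ≠ b →
      cechSign J.1 a * cechSign (J.1.erase a) b = -(cechSign J.1 b * cechSign (J.1.erase b) a) := by
    intro a b ha hb hab
    rcases lt_or_gt_of_ne hab with h | h
    · exact cechSign_antisymm ha h
    · rw [cechSign_antisymm hb h, neg_neg]
  simp only [cechD_apply, map_sum, map_zsmul, cechRes_cechRes, Finset.smul_sum, smul_smul,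
    Pi.zero_apply]
  rw [Finset.sum_sigma']
  refine Finset.sum_involution
    (fun q _ => ⟨⟨q.2.1, Finset.mem_of_mem_erase q.2.2⟩,
      ⟨q.1.1, Finset.mem_erase.mpr ⟨(Finset.ne_of_mem_erase q.2.2).symm, q.1.2⟩⟩⟩) ?_ ?_ ?_ ?_
  · rintro ⟨⟨a, ha⟩, ⟨b, hb⟩⟩ _
    have hb' : b ∈ J.1.erase a := hb
    obtain ⟨hne, hbJ⟩ := Finset.mem_erase.mp hb'
    have h1 := hanti ha hbJ hne.symm
    simp only [cechFace] at h1 ⊢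
    rw [h1, neg_smul, neg_add_eq_zero]
    congr 1
    apply hcongr
    exact Subtype.ext Finset.erase_right_comm
  · rintro ⟨⟨a, ha⟩, ⟨b, hb⟩⟩ _ _ h
    have hb' : b ∈ J.1.erase a := hb
    have := congrArg (fun q => q.1.1) h
    exact Finset.ne_of_mem_erase hb' this
  · intros; exact Finset.mem_univ _
  · rintro ⟨⟨a, ha⟩, ⟨b, hb⟩⟩ _; rfl

/-- The submodule of Čech coboundaries in degree `i`. -/
def cechCoboundaries : (i : ℕ) → Submodule A (CechCochain x i)
  | 0 => ⊥
  | i + 1 => LinearMap.range (cechD x i)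

/-- The `i`-th cohomology module of the Čech complex on `x`. If `x` generates an ideal with the
same radical as `𝔞` and `A` is Noetherian, this is the local cohomology module `H^i_𝔞(A)`. -/
abbrev CechCohomology (i : ℕ) : Type _ :=
  LinearMap.ker (cechD x i) ⧸ (cechCoboundaries x i).submoduleOf (LinearMap.ker (cechD x i))

/-- The cohomology class of a Čech cocycle. -/
abbrev cechClass (i : ℕ) : LinearMap.ker (cechD x i) →ₗ[A] CechCohomology x i :=
  Submodule.mkQ _

end Cech

/-! ### The Frobenius action on Čech cohomology -/

section Frobenius

variable (p : ℕ) [Fact p.Prime] {A : Type*} [CommRing A] [CharP A p] {s : ℕ} (x : Fin s → A)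

theorem cechLoc_add_pow {I : Finset (Fin s)} (z w : CechLoc x I) :
    (z + w) ^ p = z ^ p + w ^ p := by
  have h0 : (p : CechLoc x I) = 0 := by
    rw [← map_natCast (algebraMap A (CechLoc x I)), CharP.cast_eq_zero, map_zero]
  obtain ⟨r, hr⟩ := exists_add_pow_prime_eq (Fact.out : p.Prime) z w
  rw [hr, h0]; ring

/-- The Frobenius on Čech cochains: the `p`-th power map of each ring `A_{x_I}`. -/
def cechFrobeniusCochain (i : ℕ) : CechCochain x i →ₛₗ[frobenius A p] CechCochain x i where
  toFun c I := c I ^ p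
  map_add' c c' := by funext I; exact cechLoc_add_pow p x _ _
  map_smul' a c := by funext I; simp [smul_pow, frobenius_def]

theorem cechD_frobenius (i : ℕ) (c : CechCochain x i) :
    cechD x i (cechFrobeniusCochain p x i c) = cechFrobeniusCochain p x (i + 1) (cechD x i c) := by
  funext J
  let φ : CechLoc x J.1 →+ CechLoc x J.1 :=
    { toFun := fun z => z ^ p
      map_zero' := zero_pow (Fact.out : p.Prime).ne_zero
      map_add' := cechLoc_add_pow p x }
  change _ = φ (cechD x i c J)
  rw [cechD_apply, cechD_apply, map_sum]
  refine Finset.sum_congr rfl fun a _ => ?_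
  rw [map_zsmul]
  congr 1
  exact map_pow (cechRes x (cechFace_subset J a)) _ p

theorem cechFrobeniusCochain_mem (i : ℕ) {c : CechCochain x i} (hc : c ∈ cechCoboundaries x i) :
    cechFrobeniusCochain p x i c ∈ cechCoboundaries x i := by
  cases i with
  | zero =>
    have h0 : c = 0 := hc
    rw [h0, map_zero]; exact zero_mem _
  | succ i =>
    obtain ⟨b, rfl⟩ := hc
    exact ⟨cechFrobeniusCochain p x i b, cechD_frobenius p x i b⟩

/-- The Frobenius action `F : H^i → H^i`, induced by the `p`-th power maps on Čech cochains. -/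
def cechFrobenius (i : ℕ) : CechCohomology x i →ₛₗ[frobenius A p] CechCohomology x i :=
  Submodule.mapQ _ _
    ((cechFrobeniusCochain p x i).restrict (fun c hc => by
      rw [LinearMap.mem_ker] at hc ⊢
      rw [cechD_frobenius, hc, map_zero]))
    (by
      intro c h
      exact cechFrobeniusCochain_mem p x i h)

end Frobenius

/-! ### `F`-injective and `F`-anti-nilpotent local rings -/

section FSingularities

/-- A finite sequence generating the ideal `J`. -/
def idealGens {A : Type*} [CommRing A] [IsNoetherianRing A] (J : Ideal A) :
    Fin (Submodule.fg_iff_exists_fin_generating_family.mp (IsNoetherian.noetherian J)).choose → A :=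
  (Submodule.fg_iff_exists_fin_generating_family.mp (IsNoetherian.noetherian J)).choose_spec.choose

theorem span_idealGens {A : Type*} [CommRing A] [IsNoetherianRing A] (J : Ideal A) :
    Ideal.span (Set.range (idealGens J)) = J :=
  (Submodule.fg_iff_exists_fin_generating_family.mp
    (IsNoetherian.noetherian J)).choose_spec.choose_spec

variable (p : ℕ) [Fact p.Prime] (A : Type*) [CommRing A] [CharP A p] [IsNoetherianRing A]
  [IsLocalRing A]

/-- The local cohomology module `H^i_𝔪(A)` of a Noetherian local ring `(A, 𝔪)`, computed by the
Čech complex on a finite generating sequence of `𝔪`. -/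
abbrev LocalCoh (i : ℕ) : Type _ :=
  CechCohomology (idealGens (IsLocalRing.maximalIdeal A)) i

/-- The Frobenius action on `H^i_𝔪(A)`. -/
abbrev localCohFrobenius (i : ℕ) : LocalCoh A i →ₛₗ[frobenius A p] LocalCoh A i :=
  cechFrobenius p (idealGens (IsLocalRing.maximalIdeal A)) i

/-- `A` is `F`-injective: for all `i ≤ dim A` the Frobenius action on `H^i_𝔪(A)` is injective. -/
def IsFInjective : Prop :=
  ∀ i : ℕ, (i : WithBot ℕ∞) ≤ ringKrullDim A → Function.Injective (localCohFrobenius p A i)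

/-- `A` is `F`-anti-nilpotent: for all `i ≤ dim A` and all submodules `N ⊆ H^i_𝔪(A)` with
`F(N) ⊆ N`, the induced Frobenius action on `H^i_𝔪(A) / N` is injective. -/
def IsFAntiNilpotent : Prop :=
  ∀ i : ℕ, (i : WithBot ℕ∞) ≤ ringKrullDim A →
    ∀ (N : Submodule A (LocalCoh A i)) (hN : N ≤ N.comap (localCohFrobenius p A i)),
      Function.Injective (N.mapQ N (localCohFrobenius p A i) hN)

end FSingularities

/-! ### Graded rings -/

section Graded

variable {k : Type*} [Field k] {R : Type*} [CommRing R] [Algebra k R] (𝒜 : ℕ → Submodule k R)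

/-- The degree zero part of the `ℕ`-grading is the field `k`, that is, `k → R` is injective with
image `R_0`. -/
class IsConnectedGrading : Prop where
  algebraMap_injective : Function.Injective (algebraMap k R)
  zero_eq_one : 𝒜 0 = 1

/-- The graded pieces indexed by `ℤ`, with zero pieces in negative degrees. -/
def intPiece : ℤ → Submodule k R
  | Int.ofNat a => 𝒜 a
  | Int.negSucc _ => ⊥

theorem mul_mem_intPiece [GradedAlgebra 𝒜] {m : ℤ} {a : ℕ} {r y : R} (hr : r ∈ intPiece 𝒜 m)
    (hy : y ∈ 𝒜 a) : r * y ∈ intPiece 𝒜 (m + a) := by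
  cases m with
  | ofNat b =>
    have hr' : r ∈ 𝒜 b := hr
    exact SetLike.GradedMul.mul_mem (A := 𝒜) hr' hy
  | negSucc b =>
    have h0 : r = 0 := hr
    rw [h0, zero_mul]; exact zero_mem _

section Pieces

variable [GradedAlgebra 𝒜] {s : ℕ} (x : Fin s → R) (e : Fin s → ℕ)

/-- For `x_j` homogeneous of degree `e_j`, the degree `m` part of `R_{x_I}`: the fractions
`r / x_I ^ N` with `r` homogeneous of degree `m + N * ∑_{j ∈ I} e_j`. -/
def cechLocPiece (hx : ∀ j, x j ∈ 𝒜 (e j)) (I : Finset (Fin s)) (m : ℤ) :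
    Submodule k (CechLoc x I) where
  carrier := {z | ∃ (N : ℕ) (r : R), r ∈ intPiece 𝒜 (m + N * ∑ j ∈ I, (e j : ℤ)) ∧
    z * algebraMap R (CechLoc x I) ((∏ j ∈ I, x j) ^ N) = algebraMap R (CechLoc x I) r}
  zero_mem' := ⟨0, 0, zero_mem _, by simp⟩
  add_mem' := by
    rintro z w ⟨N, r, hr, h⟩ ⟨M, t, ht, h'⟩
    have hI : ∏ j ∈ I, x j ∈ 𝒜 (∑ j ∈ I, e j) := SetLike.prod_mem_graded 𝒜 e x fun j _ => hx j
    have hN : (∏ j ∈ I, x j) ^ N ∈ 𝒜 (N * ∑ j ∈ I, e j) := SetLike.pow_mem_graded N hI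
    have hM : (∏ j ∈ I, x j) ^ M ∈ 𝒜 (M * ∑ j ∈ I, e j) := SetLike.pow_mem_graded M hI
    refine ⟨N + M, r * (∏ j ∈ I, x j) ^ M + t * (∏ j ∈ I, x j) ^ N, add_mem ?_ ?_, ?_⟩
    · convert mul_mem_intPiece 𝒜 hr hM using 2
      push_cast; ring
    · convert mul_mem_intPiece 𝒜 ht hN using 2
      push_cast; ring
    · rw [map_add, map_mul, map_mul, ← h, ← h', pow_add, map_mul]; ring
  smul_mem' := by
    rintro c z ⟨N, r, hr, h⟩
    refine ⟨N, c • r, Submodule.smul_mem _ _ hr, ?_⟩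
    rw [smul_mul_assoc, h]
    exact (map_smul (IsScalarTower.toAlgHom k R (CechLoc x I)) c r).symm

/-- The degree `m` component `[H^i]_m` of Čech cohomology: the classes of the cocycles all of
whose components are homogeneous of degree `m`. -/
def cechCohomologyPiece (hx : ∀ j, x j ∈ 𝒜 (e j)) (i : ℕ) (m : ℤ) :
    Submodule k (CechCohomology x i) :=
  Submodule.map ((cechClass x i).restrictScalars k)
    (Submodule.comap ((LinearMap.ker (cechD x i)).subtype.restrictScalars k)
      (Submodule.pi Set.univ fun I => cechLocPiece 𝒜 x e hx I.1 m))

end Pieces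

section Veronese

variable [GradedAlgebra 𝒜] (n : ℕ)

/-- The `n`-th Veronese subring `R^{(n)} = ⨁_{t ≥ 0} R_{nt}`. -/
def veronese : Subalgebra k R :=
  (⨆ t : ℕ, 𝒜 (n * t)).toSubalgebra
    (Submodule.mem_iSup_of_mem 0 (by rw [mul_zero]; exact SetLike.GradedOne.one_mem))
    (by
      intro a b ha hb
      have h := Submodule.mul_mem_mul ha hb
      rw [Submodule.iSup_mul] at h
      simp only [Submodule.mul_iSup] at h
      refine (iSup_le fun t => iSup_le fun u => ?_ :
        (⨆ t : ℕ, ⨆ u : ℕ, 𝒜 (n * t) * 𝒜 (n * u)) ≤ ⨆ t : ℕ, 𝒜 (n * t)) h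
      refine Submodule.mul_le.mpr fun y hy z hz => Submodule.mem_iSup_of_mem (t + u) ?_
      rw [mul_add]
      exact SetLike.GradedMul.mul_mem hy hz)

/-- The homogeneous maximal ideal of `R^{(n)}`, the elements of `R^{(n)}` without constant term. -/
def veroneseIrrelevant : Ideal (veronese 𝒜 n) :=
  (HomogeneousIdeal.irrelevant 𝒜).toIdeal.comap (veronese 𝒜 n).val

instance [IsConnectedGrading 𝒜] : (veroneseIrrelevant 𝒜 n).IsPrime := by
  have hinj : Function.Injective (algebraMap k R) :=
    IsConnectedGrading.algebraMap_injective 𝒜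
  have : Nontrivial R := hinj.nontrivial
  have hproj : ∀ r : R, ∃ c : k, algebraMap k R c = GradedRing.projZeroRingHom 𝒜 r := by
    intro r
    have h : GradedRing.projZeroRingHom 𝒜 r ∈ 𝒜 0 := by
      rw [GradedRing.projZeroRingHom_apply]; exact SetLike.coe_mem _
    rw [IsConnectedGrading.zero_eq_one (𝒜 := 𝒜)] at h
    exact Submodule.mem_one.mp h
  have hmem : ∀ r : R, r ∈ (HomogeneousIdeal.irrelevant 𝒜).toIdeal ↔
      GradedRing.projZeroRingHom 𝒜 r = 0 := fun r => Iff.rfl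
  have hprime : (HomogeneousIdeal.irrelevant 𝒜).toIdeal.IsPrime := by
    refine Ideal.isPrime_iff.mpr ⟨?_, ?_⟩
    · rw [Ideal.ne_top_iff_one, hmem, map_one]; exact one_ne_zero
    · intro a b hab
      rw [hmem] at hab ⊢
      rw [hmem]
      obtain ⟨c, hc⟩ := hproj a
      obtain ⟨d, hd⟩ := hproj b
      rw [map_mul, ← hc, ← hd, ← map_mul, map_eq_zero_iff _ hinj, mul_eq_zero] at hab
      rw [← hc, ← hd, map_eq_zero_iff _ hinj, map_eq_zero_iff _ hinj]
      exact hab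
  exact Ideal.comap_isPrime _ _

/-- The projection `R → R` onto the components of degree divisible by `n`. -/
def veroneseProj : R →ₗ[k] R :=
  DirectSum.coeLinearMap 𝒜 ∘ₗ DFinsupp.filterLinearMap k (fun d => 𝒜 d) (n ∣ ·) ∘ₗ
    (DirectSum.decomposeLinearEquiv 𝒜).toLinearMap

theorem veroneseProj_of_mem {d : ℕ} {r : R} (hr : r ∈ 𝒜 d) :
    veroneseProj 𝒜 n r = if n ∣ d then r else 0 := by
  lift r to 𝒜 d using hr
  simp only [veroneseProj, LinearMap.comp_apply, LinearEquiv.coe_coe,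
    DirectSum.decomposeLinearEquiv_apply, DirectSum.decompose_coe]
  have : DFinsupp.filterLinearMap k (fun d => 𝒜 d) (n ∣ ·) (DirectSum.of (fun d => 𝒜 d) d r) =
      if n ∣ d then DirectSum.of (fun d => 𝒜 d) d r else 0 :=
    DFinsupp.filter_single _ _ _
  rw [this]
  split_ifs
  · exact DirectSum.coeLinearMap_of 𝒜 d r
  · exact map_zero _

theorem veroneseProj_mul {a : R} (ha : a ∈ veronese 𝒜 n) (r : R) :
    veroneseProj 𝒜 n (r * a) = veroneseProj 𝒜 n r * a := by
  have ha' : a ∈ ⨆ t : ℕ, 𝒜 (n * t) := ha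
  clear ha
  induction ha' using Submodule.iSup_induction' with
  | mem t a hat =>
    induction r using DirectSum.Decomposition.inductionOn 𝒜 with
    | zero => simp
    | @homogeneous d r =>
      rw [veroneseProj_of_mem 𝒜 n (SetLike.GradedMul.mul_mem r.2 hat),
        veroneseProj_of_mem 𝒜 n r.2]
      simp only [Nat.dvd_add_left (Dvd.intro t rfl : n ∣ n * t), ite_mul, zero_mul]
    | add r r' h h' => rw [add_mul, map_add, map_add, h, h', add_mul]
  | zero => simp
  | add a b ha hb iha ihb => rw [mul_add, map_add, iha, ihb, mul_add]

theorem veroneseProj_mem (r : R) : veroneseProj 𝒜 n r ∈ veronese 𝒜 n := by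
  induction r using DirectSum.Decomposition.inductionOn 𝒜 with
  | zero => rw [map_zero]; exact zero_mem _
  | @homogeneous d r =>
    rw [veroneseProj_of_mem 𝒜 n r.2]
    split_ifs with h
    · obtain ⟨t, rfl⟩ := h
      exact (Submodule.mem_iSup_of_mem t r.2 : (r : R) ∈ ⨆ t : ℕ, 𝒜 (n * t))
    · exact zero_mem _
  | add r r' h h' => rw [map_add]; exact add_mem h h'

theorem comap_map_veronese (I : Ideal (veronese 𝒜 n)) :
    (I.map (veronese 𝒜 n).val).comap (veronese 𝒜 n).val = I := by
  refine le_antisymm (fun y hy => ?_) Ideal.le_comap_map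
  have key : ∀ z ∈ I.map (veronese 𝒜 n).val, ∀ r : R,
      ∃ w ∈ I, (w : R) = veroneseProj 𝒜 n (r * z) := by
    intro z hz
    induction hz using Submodule.span_induction with
    | mem z h =>
      obtain ⟨w, hw, rfl⟩ := h
      exact fun r => ⟨⟨_, veroneseProj_mem 𝒜 n r⟩ * w, I.mul_mem_left _ hw,
        (veroneseProj_mul 𝒜 n w.2 r).symm⟩
    | zero => exact fun r => ⟨0, zero_mem _, by simp⟩
    | add z z' _ _ h h' =>
      intro r
      obtain ⟨w, hw, e⟩ := h r
      obtain ⟨w', hw', e'⟩ := h' r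
      exact ⟨w + w', add_mem hw hw', by rw [mul_add, map_add, ← e, ← e']; rfl⟩
    | smul r z hz h =>
      intro r'
      obtain ⟨w, hw, e⟩ := h (r' * r)
      exact ⟨w, hw, by rw [e, smul_eq_mul, mul_assoc]⟩
  obtain ⟨w, hw, e⟩ := key _ hy 1
  have h1 : veroneseProj 𝒜 n (1 * (y : R)) = y := by
    rw [veroneseProj_mul 𝒜 n y.2 1, veroneseProj_of_mem 𝒜 n SetLike.GradedOne.one_mem,
      if_pos (dvd_zero n), one_mul]
  have : w = y := Subtype.ext (e.trans h1)
  exact this ▸ hw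

instance [IsNoetherianRing R] : IsNoetherianRing (veronese 𝒜 n) := by
  let f : Ideal (veronese 𝒜 n) ↪o Ideal R :=
    OrderEmbedding.ofMapLEIff (fun I => I.map (veronese 𝒜 n).val) fun I J =>
      ⟨fun h => by
        have := Ideal.comap_mono (f := (veronese 𝒜 n).val) h
        rwa [comap_map_veronese, comap_map_veronese] at this, fun h => Ideal.map_mono h⟩
  rw [isNoetherianRing_iff, isNoetherian_iff]
  exact f.dual.wellFounded (isNoetherian_iff.mp ‹IsNoetherianRing R›)

instance (p : ℕ) [CharP R p] : CharP (veronese 𝒜 n) p :=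
  ((veronese 𝒜 n).val.toRingHom.charP_iff Subtype.val_injective p).mpr inferInstance

instance (p : ℕ) [Fact p.Prime] [CharP R p] [IsConnectedGrading 𝒜] :
    CharP (Localization.AtPrime (veroneseIrrelevant 𝒜 n)) p := by
  rw [CharP.charP_iff_prime_eq_zero Fact.out, ← map_natCast (algebraMap (veronese 𝒜 n) _),
    CharP.cast_eq_zero, map_zero]

end Veronese

end Graded

end

/-! The local cohomology of the Veronese subring `T` is `⨁_t [H^i_𝔪(R)]_{tn}`, with the restricted
Frobenius. In degrees `tn` with `t < 0` the Frobenius is injective because `|t| n ≥ n ≥ n₀`; in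
degree zero it is injective by hypothesis; in degrees `tn` with `t > 0` there is nothing. Hence `F`
is injective on the cohomology of `T`.

An element of `T` of positive degree `tn` sends degree zero into degree `tn`, where the cohomology
vanishes. So `T` acts on the degree zero part through its constants `k`, and every `k`-subspace
there is a `T`-submodule. In particular `V` is one, it is `F`-stable, and `η` is a nonzero nilpotent
class modulo `V`. Elements of `T` outside `𝔫` act on `η` as nonzero scalars, so `η` survives in the
quotient after localizing at `𝔫`.

The graded comparison is carried by `veroneseCohMap_injective`, `exists_veroneseCohMap_eq` and
`exists_veronese_submodule`; the passage to `T_𝔫` by `cechFrobenius_injective_of_isLocalization` and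
`exists_submodule_of_isLocalization`. Two facts link this to the definitions for local rings.
`LocalCoh` uses an arbitrary generating sequence of the maximal ideal, whereas the computation uses
the images of the `x_j ^ n`; `exists_cechCohomology_equiv` shows that only the radical matters. And
`F`-anti-nilpotence only tests degrees up to the dimension; `subsingleton_localCoh` shows that the
degree of `η` cannot exceed it. -/

noncomputable section

/-! ### Acyclicity of the Čech cochains that vanish on a subsequence with the same radical. -/

section TotalCochains

variable {A : Type*} [CommRing A] {s : ℕ} (w : Fin s → A)

/-- Sections over index sets that are equal only propositionally live in different types; comparing
them after restriction to a common `J` avoids casts. -/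
theorem cechRes_congr {I I' J : Finset (Fin s)} (c : ∀ I, CechLoc w I) (e : I = I') (h : I ⊆ J)
    (h' : I' ⊆ J) : cechRes w h (c I) = cechRes w h' (c I') := by
  subst e; rfl

/-- For `r ∉ I` the ring at `insert r I` is the localization at `w r` of the ring at `I`. This is
the clearing of denominators; the next lemma is the description of the kernel. -/
theorem exists_cechRes_eq_smul {I : Finset (Fin s)} {r : Fin s} (hr : r ∉ I)
    (z : CechLoc w (insert r I)) :
    ∃ (N : ℕ) (y : CechLoc w I), cechRes w (Finset.subset_insert r I) y = w r ^ N • z := by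
  obtain ⟨N, a, h⟩ := IsLocalization.Away.surj (∏ j ∈ insert r I, w j) z
  have hu : IsUnit (algebraMap A (CechLoc w I) ((∏ j ∈ I, w j) ^ N)) := by
    rw [map_pow]; exact (isUnit_cechLoc w (Finset.Subset.refl I)).pow N
  have hu' : IsUnit (algebraMap A (CechLoc w (insert r I)) ((∏ j ∈ I, w j) ^ N)) := by
    rw [map_pow]; exact (isUnit_cechLoc w (Finset.subset_insert r I)).pow N
  obtain ⟨v, hv⟩ := hu.exists_left_inv
  refine ⟨N, v * algebraMap A _ a, hu'.mul_left_injective ?_⟩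
  have h1 : cechRes w (Finset.subset_insert r I) v *
      algebraMap A (CechLoc w (insert r I)) ((∏ j ∈ I, w j) ^ N) = 1 := by
    rw [← AlgHom.commutes (cechRes w (Finset.subset_insert r I)), ← map_mul, hv, map_one]
  simp only [map_mul, AlgHom.commutes]
  rw [mul_right_comm, h1, one_mul, ← h, ← map_pow]
  simp only [Finset.prod_insert hr, mul_pow, map_mul, Algebra.smul_def]
  ring

theorem exists_smul_eq_zero_of_cechRes {I : Finset (Fin s)} {r : Fin s} (hr : r ∉ I)
    {y : CechLoc w I} (hy : cechRes w (Finset.subset_insert r I) y = 0) :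
    ∃ N : ℕ, w r ^ N • y = 0 := by
  obtain ⟨N, a, h⟩ := IsLocalization.Away.surj (∏ j ∈ I, w j) y
  have h0 : algebraMap A (CechLoc w (insert r I)) a = algebraMap A _ 0 := by
    rw [← AlgHom.commutes (cechRes w (Finset.subset_insert r I)), ← h, map_mul, hy, zero_mul,
      map_zero]
  obtain ⟨M, hM⟩ := IsLocalization.Away.exists_of_eq (∏ j ∈ insert r I, w j) h0
  have hu : IsUnit (algebraMap A (CechLoc w I) ((∏ j ∈ I, w j) ^ (N + M))) := by
    rw [map_pow]; exact (isUnit_cechLoc w (Finset.Subset.refl I)).pow _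
  refine ⟨M, hu.mul_left_injective ?_⟩
  simp only [zero_mul]
  rw [mul_zero, Finset.prod_insert hr] at hM
  rw [Algebra.smul_def, pow_add, map_mul]
  calc _ = (y * algebraMap A _ (∏ j ∈ I, w j) ^ N) *
        algebraMap A _ ((w r * ∏ j ∈ I, w j) ^ M) := by simp only [map_pow, map_mul]; ring
    _ = 0 := by rw [h, ← map_mul, mul_comm a, hM, map_zero]

/-- The differential on families of sections indexed by all subsets. -/
def cechTotalD : (∀ I, CechLoc w I) →ₗ[A] (∀ I, CechLoc w I) where
  toFun c J := ∑ a : J, cechSign J a.1 • cechRes w (Finset.erase_subset a.1 J) (c (J.erase a.1))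
  map_add' c c' := by
    funext J
    simp only [Pi.add_apply, map_add, smul_add, Finset.sum_add_distrib]
  map_smul' r c := by
    funext J
    simp only [Pi.smul_apply, map_smul, Finset.smul_sum, RingHom.id_apply]
    exact Finset.sum_congr rfl fun a _ => smul_comm _ _ _

theorem cechTotalD_apply (c : ∀ I, CechLoc w I) (J : Finset (Fin s)) :
    cechTotalD w c J = ∑ a : J, cechSign J a.1 •
      cechRes w (Finset.erase_subset a.1 J) (c (J.erase a.1)) := rfl

theorem cechSign_mul_self (J : Finset (Fin s)) (a : Fin s) : cechSign J a * cechSign J a = 1 := by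
  rw [cechSign, ← pow_add, ← two_mul, pow_mul]; simp

theorem cechSign_antisymm' {J : Finset (Fin s)} {a b : Fin s} (ha : a ∈ J) (hb : b ∈ J)
    (hab : a ≠ b) :
    cechSign J a * cechSign (J.erase a) b = -(cechSign J b * cechSign (J.erase b) a) := by
  rcases lt_or_gt_of_ne hab with h | h
  · exact cechSign_antisymm ha h
  · rw [cechSign_antisymm hb h, neg_neg]

/-- A sum over `insert r J` splits off the term at `r`. -/
theorem sum_coe_insert {M : Type*} [AddCommMonoid M] {J : Finset (Fin s)} {r : Fin s} (hr : r ∉ J)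
    (f : {a // a ∈ insert r J} → M) :
    ∑ a, f a = f ⟨r, Finset.mem_insert_self r J⟩ +
      ∑ a : J, f ⟨a.1, Finset.mem_insert_of_mem a.2⟩ := by
  classical
  let g : Fin s → M := fun a => if h : a ∈ insert r J then f ⟨a, h⟩ else 0
  have h1 : ∑ a, f a = ∑ a ∈ insert r J, g a := by
    refine Eq.trans (Finset.sum_congr rfl fun a _ => ?_) (Finset.sum_coe_sort (insert r J) g)
    simp only [g]
    rw [dif_pos a.2]
  rw [h1, Finset.sum_insert hr, ← Finset.sum_coe_sort J]
  congr 1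
  · simp [g]
  · exact Finset.sum_congr rfl fun a _ => by
      simp only [g]; rw [dif_pos (Finset.mem_insert_of_mem a.2)]

/-- A cocycle becomes a coboundary after multiplication by a power of any `w r`. -/
theorem exists_cechTotalD_eq_smul {c : ∀ I, CechLoc w I} (hc : cechTotalD w c = 0) (r : Fin s) :
    ∃ (N : ℕ) (b : ∀ I, CechLoc w I), cechTotalD w b = w r ^ N • c ∧
      ∀ I, c (insert r I) = 0 → b I = 0 := by
  classical
  have key : ∀ I : Finset (Fin s), ∃ (N : ℕ) (y : CechLoc w I), r ∉ I →
      cechRes w (Finset.subset_insert r I) y =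
        w r ^ N • cechSign (insert r I) r • c (insert r I) := by
    intro I
    by_cases hr : r ∈ I
    · exact ⟨0, 0, fun h => (h hr).elim⟩
    · obtain ⟨N, y, h⟩ := exists_cechRes_eq_smul w hr (cechSign (insert r I) r • c (insert r I))
      exact ⟨N, y, fun _ => h⟩
  choose N₀ y₀ hy₀ using key
  -- There are finitely many index sets, so one exponent clears all denominators.
  let N := Finset.univ.sup N₀
  -- After inverting `w r`, the Čech complex is contracted by `c ↦ (± c (insert r I))` for `r ∉ I`.
  -- This is that homotopy, multiplied by `w r ^ N` to make it defined without inverting. The value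
  -- is forced to zero where `c (insert r I) = 0`, since a lift of zero may be nonzero torsion.
  let b : ∀ I, CechLoc w I := fun I =>
    if r ∈ I ∨ c (insert r I) = 0 then 0 else w r ^ (N - N₀ I) • y₀ I
  have hb1 : ∀ I, r ∈ I → b I = 0 := fun I h => if_pos (Or.inl h)
  have hb2 : ∀ I, c (insert r I) = 0 → b I = 0 := fun I h => if_pos (Or.inr h)
  have hb3 : ∀ I, r ∉ I → cechRes w (Finset.subset_insert r I) (b I) =
      w r ^ N • cechSign (insert r I) r • c (insert r I) := by
    intro I hr
    by_cases h0 : c (insert r I) = 0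
    · rw [hb2 I h0, h0, map_zero, zsmul_zero, smul_zero]
    · have : b I = w r ^ (N - N₀ I) • y₀ I := if_neg (by tauto)
      rw [this, map_smul, hy₀ I hr, smul_smul, ← pow_add,
        Nat.sub_add_cancel (Finset.le_sup (Finset.mem_univ I))]
  -- the error term
  have herr : ∀ J, ∃ M : ℕ, w r ^ M • (cechTotalD w b - w r ^ N • c) J = 0 := by
    intro J
    by_cases hr : r ∈ J
    -- For `r ∈ J` the identity is exact: only the face omitting `r` contributes, as `b` vanishes on
    -- sets containing `r`.
    · refine ⟨0, ?_⟩
      obtain ⟨I, hI, rfl⟩ : ∃ I, r ∉ I ∧ J = insert r I :=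
        ⟨J.erase r, Finset.notMem_erase r J, (Finset.insert_erase hr).symm⟩
      rw [pow_zero, one_smul, Pi.sub_apply, cechTotalD_apply, sum_coe_insert hI,
        Finset.sum_eq_zero, add_zero, sub_eq_zero]
      · rw [cechRes_congr w b (Finset.erase_insert hI) _ (Finset.subset_insert r I), hb3 I hI,
          smul_comm, smul_smul, cechSign_mul_self, one_smul]
        rfl
      · intro a _
        rw [hb1, map_zero, zsmul_zero]
        exact Finset.mem_erase.mpr ⟨fun h => hI (h ▸ a.2), Finset.mem_insert_self r I⟩
    -- For `r ∉ J` the identity holds only after restriction to `insert r J`, by the cocycle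
    -- condition there; the error is killed by a power of `w r`.
    · apply exists_smul_eq_zero_of_cechRes w hr
      have h0 := congrFun hc (insert r J)
      rw [cechTotalD_apply, sum_coe_insert hr] at h0
      rw [Pi.sub_apply, map_sub, cechTotalD_apply, map_sum, sub_eq_zero]
      have h1 : ∀ a : J, cechRes w (Finset.subset_insert r J)
          (cechSign J a.1 • cechRes w (Finset.erase_subset a.1 J) (b (J.erase a.1))) =
          - (w r ^ N • cechSign (insert r J) r • cechSign (insert r J) a.1 •
            cechRes w (Finset.erase_subset a.1 (insert r J)) (c ((insert r J).erase a.1))) := by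
        rintro ⟨a, ha⟩
        have hra : r ≠ a := fun h => hr (h ▸ ha)
        have hrJ : r ∉ J.erase a := fun h => hr (Finset.mem_of_mem_erase h)
        have hins : insert r (J.erase a) = (insert r J).erase a :=
          (Finset.erase_insert_of_ne hra).symm
        rw [map_zsmul, cechRes_cechRes,
          ← cechRes_cechRes w (Finset.subset_insert r (J.erase a))
            (Finset.insert_subset_insert r (Finset.erase_subset a J)), hb3 _ hrJ, map_smul,
          map_zsmul, cechRes_congr w c hins _ (Finset.erase_subset a (insert r J)), hins,
          smul_comm, smul_smul, smul_smul, ← smul_neg, ← neg_smul]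
        congr 2
        have h2 := cechSign_antisymm' (Finset.mem_insert_self r J) (Finset.mem_insert_of_mem ha) hra
        rw [Finset.erase_insert hr] at h2
        have h3 := cechSign_mul_self (insert r J) r
        have h4 := cechSign_mul_self ((insert r J).erase a) r
        linear_combination cechSign ((insert r J).erase a) r * cechSign (insert r J) r * h2 -
          cechSign J a * cechSign ((insert r J).erase a) r * h3 -
          cechSign (insert r J) a * cechSign (insert r J) r * h4
      rw [Finset.sum_congr rfl fun a _ => h1 a, Finset.sum_neg_distrib, ← Finset.smul_sum,
        Finset.sum_zsmul, eq_neg_of_add_eq_zero_right h0, zsmul_neg, smul_neg, neg_neg,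
        smul_smul (cechSign _ _), cechSign_mul_self, one_smul, Pi.smul_apply, map_smul]
      congr 1
      exact cechRes_congr w c (Finset.erase_insert hr) _ _
  choose M hM using herr
  refine ⟨N + Finset.univ.sup M, w r ^ (Finset.univ.sup M) • b, ?_, fun I h => ?_⟩
  · rw [map_smul, ← sub_eq_zero, add_comm, pow_add, mul_smul, ← smul_sub]
    funext J
    rw [Pi.smul_apply, ← Nat.sub_add_cancel (Finset.le_sup (f := M) (Finset.mem_univ J)), pow_add,
      mul_smul, hM, smul_zero, Pi.zero_apply]
  · rw [Pi.smul_apply, hb2 I h, smul_zero]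

theorem cechTotalD_cechTotalD (c : ∀ I, CechLoc w I) : cechTotalD w (cechTotalD w c) = 0 := by
  funext J
  rcases Nat.lt_or_ge J.card 2 with h | h
  · rw [cechTotalD_apply]
    refine Finset.sum_eq_zero fun a _ => ?_
    have : J.erase a.1 = ∅ := by
      rw [← Finset.card_eq_zero, Finset.card_erase_of_mem a.2]; omega
    rw [cechTotalD_apply, Finset.sum_eq_zero, map_zero, zsmul_zero]
    intro b _
    exact (Finset.notMem_empty b.1 (this ▸ b.2)).elim
  · obtain ⟨i, hi⟩ := Nat.exists_eq_add_of_le' h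
    -- The component at `J` only involves sets with two elements fewer, so the identity in a single
    -- degree applies.
    exact congrFun (cechD_comp_cechD w i fun I => c I.1) ⟨J, hi⟩

/-- Cocycles vanishing on the subsets of `P` are coboundaries of such, if all elements of the
sequence are in the radical of the ideal generated by those with index in `P`. -/
theorem exists_cechTotalD_eq {P : Finset (Fin s)}
    (hP : ∀ q, w q ∈ (Ideal.span (w '' P)).radical) {c : ∀ I, CechLoc w I}
    (hc : cechTotalD w c = 0) (hcP : ∀ I ⊆ P, c I = 0) :
    ∃ b : ∀ I, CechLoc w I, cechTotalD w b = c ∧ ∀ I ⊆ P, b I = 0 := by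
  classical
  -- The set `P` is enlarged one index at a time, correcting `c` by a coboundary, until `c` vanishes
  -- everywhere.
  induction hk : Pᶜ.card generalizing P c with
  | zero =>
    have : P = Finset.univ := by rwa [Finset.card_eq_zero, Finset.compl_eq_empty_iff] at hk
    subst this
    exact ⟨0, by rw [map_zero]; funext I; exact (hcP I (Finset.subset_univ I)).symm,
      fun _ _ => rfl⟩
  | succ k ih =>
    obtain ⟨q, hq⟩ : ∃ q, q ∈ Pᶜ := Finset.card_pos.mp (hk ▸ Nat.succ_pos k)
    have hqP : q ∉ P := Finset.mem_compl.mp hq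
    -- `w q ^ M` times `c` is a coboundary
    let I₀ : Ideal A :=
      { carrier := {a | ∃ b : ∀ I, CechLoc w I, cechTotalD w b = a • c ∧ ∀ I ⊆ P, b I = 0}
        zero_mem' := ⟨0, by simp, fun _ _ => rfl⟩
        add_mem' := by
          rintro a a' ⟨b, h, h0⟩ ⟨b', h', h0'⟩
          exact ⟨b + b', by rw [map_add, h, h', add_smul], fun I hI => by
            rw [Pi.add_apply, h0 I hI, h0' I hI, add_zero]⟩
        smul_mem' := by
          rintro t a ⟨b, h, h0⟩
          exact ⟨t • b, by rw [map_smul, h, smul_smul, smul_eq_mul], fun I hI => by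
            rw [Pi.smul_apply, h0 I hI, smul_zero]⟩ }
    have hI₀ : Ideal.span (w '' P) ≤ I₀.radical := by
      refine Ideal.span_le.mpr ?_
      rintro _ ⟨r, hr, rfl⟩
      obtain ⟨N, b, h, h0⟩ := exists_cechTotalD_eq_smul w hc r
      exact ⟨N, b, h, fun I hI => h0 I (hcP _ (Finset.insert_subset hr hI))⟩
    -- The ideal `I₀` contains a power of each `w r` with `r ∈ P`, hence also a power of `w q`.
    obtain ⟨M, b, hb, hb0⟩ : w q ∈ I₀.radical := by
      have := Ideal.radical_mono hI₀ (hP q)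
      rwa [Ideal.radical_idem] at this
    have hunit : ∀ J : Finset (Fin s), ∃ v : CechLoc w J,
        q ∈ J → v * algebraMap A _ (w q ^ M) = 1 := by
      intro J
      by_cases h : q ∈ J
      · have := isUnit_cechLoc w (Finset.singleton_subset_iff.mpr h)
        rw [Finset.prod_singleton] at this
        obtain ⟨v, hv⟩ := (this.pow M).exists_left_inv
        exact ⟨v, fun _ => by rw [map_pow]; exact hv⟩
      · exact ⟨0, fun h' => (h h').elim⟩
    choose v hv using hunit
    have hvres : ∀ {I J : Finset (Fin s)} (h : I ⊆ J), q ∈ I → cechRes w h (v I) = v J := by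
      intro I J h hqI
      have h1 := congrArg (cechRes w h) (hv I hqI)
      rw [map_mul, AlgHom.commutes, map_one] at h1
      calc _ = cechRes w h (v I) * (v J * algebraMap A _ (w q ^ M)) := by rw [hv J (h hqI), mul_one]
        _ = v J * (cechRes w h (v I) * algebraMap A _ (w q ^ M)) := by ring
        _ = v J := by rw [h1, mul_one]
    -- Where `q ∈ I`, the element `w q` is invertible and `b` can be divided by `w q ^ M`. On `J ⊆
    -- insert q P` containing `q`, the one face without `q` lies in `P`, where `b` is zero, so the
    -- truncation does not affect the differential.
    let b' : ∀ I, CechLoc w I := fun I => if q ∈ I then v I * b I else 0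
    have hb'P : ∀ I ⊆ P, b' I = 0 := fun I hI => if_neg fun h => hqP (hI h)
    have hc' : ∀ I ⊆ insert q P, (c - cechTotalD w b') I = 0 := by
      intro J hJ
      rw [Pi.sub_apply, sub_eq_zero]
      by_cases hqJ : q ∈ J
      · have h1 : cechTotalD w b' J = v J * cechTotalD w b J := by
          rw [cechTotalD_apply, cechTotalD_apply, Finset.mul_sum]
          refine Finset.sum_congr rfl fun a _ => ?_
          rw [mul_smul_comm]
          congr 1
          by_cases haq : a.1 = q
          · have hsub : J.erase a.1 ⊆ P := by
              rw [haq]; exact (Finset.subset_insert_iff).mp hJ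
            rw [hb'P _ hsub, hb0 _ hsub, map_zero, mul_zero]
          · have hqa : q ∈ J.erase a.1 := Finset.mem_erase.mpr ⟨Ne.symm haq, hqJ⟩
            have : b' (J.erase a.1) = v (J.erase a.1) * b (J.erase a.1) := if_pos hqa
            rw [this, map_mul, hvres _ hqa]
        rw [h1, hb, Pi.smul_apply, Algebra.smul_def, ← mul_assoc, hv J hqJ, one_mul]
      · have hJP : J ⊆ P := (Finset.subset_insert_iff_of_notMem hqJ).mp hJ
        rw [hcP J hJP, cechTotalD_apply]
        refine (Finset.sum_eq_zero fun a _ => ?_).symm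
        rw [hb'P _ ((Finset.erase_subset _ _).trans hJP), map_zero, zsmul_zero]
    obtain ⟨b'', h, h0⟩ := ih (P := insert q P)
      (fun q' => Ideal.radical_mono (Ideal.span_mono (Set.image_mono
        (Finset.coe_subset.mpr (Finset.subset_insert q P)))) (hP q'))
      (c := c - cechTotalD w b')
      (by rw [map_sub, hc, cechTotalD_cechTotalD, sub_zero]) hc'
      (by rw [Finset.compl_insert, Finset.card_erase_of_mem hq, hk, Nat.add_sub_cancel])
    exact ⟨b'' + b', by rw [map_add, h, sub_add_cancel], fun I hI => by
      rw [Pi.add_apply, hb'P I hI, h0 I (hI.trans (Finset.subset_insert q P)), add_zero]⟩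

/-- Extension by zero of a cochain of degree `i` to all subsets. -/
def cechExtend (i : ℕ) (c : CechCochain w i) : ∀ I, CechLoc w I :=
  fun I => if h : I.card = i then c ⟨I, h⟩ else 0

theorem cechExtend_apply {i : ℕ} (c : CechCochain w i) (I : {I : Finset (Fin s) // I.card = i}) :
    cechExtend w i c I.1 = c I :=
  dif_pos I.2

theorem cechTotalD_cechExtend {i : ℕ} (c : CechCochain w i) :
    cechTotalD w (cechExtend w i c) = cechExtend w (i + 1) (cechD w i c) := by
  funext J
  by_cases h : J.card = i + 1
  · rw [cechExtend_apply w (cechD w i c) ⟨J, h⟩, cechD_apply]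
    exact Finset.sum_congr rfl fun a _ => by
      rw [← cechExtend_apply w c (cechFace ⟨J, h⟩ a)]; rfl
  · rw [cechExtend, dif_neg h]
    refine Finset.sum_eq_zero fun a _ => ?_
    rw [cechExtend, dif_neg, map_zero, zsmul_zero]
    rw [Finset.card_erase_of_mem a.2]
    have := Finset.card_pos.mpr ⟨a.1, a.2⟩
    omega

end TotalCochains

/-! ### Functoriality of Čech cohomology under semilinear cochain maps. -/

section CohomologyMap

variable {A A' : Type*} [CommRing A] [CommRing A'] {σ : A →+* A'} {s s' : ℕ} {x : Fin s → A}
  {x' : Fin s' → A'}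

theorem cechClass_eq_zero_iff {i : ℕ} (c : LinearMap.ker (cechD x i)) :
    cechClass x i c = 0 ↔ c.1 ∈ cechCoboundaries x i :=
  (Submodule.Quotient.mk_eq_zero _).trans Iff.rfl

theorem cechClass_surjective (i : ℕ) : Function.Surjective (cechClass x i) :=
  Submodule.mkQ_surjective _

variable (f : ∀ i, CechCochain x i →ₛₗ[σ] CechCochain x' i)

theorem map_mem_cechCoboundaries
    (hf : ∀ i c, cechD x' i (f i c) = f (i + 1) (cechD x i c)) {i : ℕ} {c : CechCochain x i}
    (hc : c ∈ cechCoboundaries x i) : f i c ∈ cechCoboundaries x' i := by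
  cases i with
  | zero =>
    have h0 : c = 0 := hc
    rw [h0, map_zero]; exact zero_mem _
  | succ i =>
    obtain ⟨b, rfl⟩ := hc
    exact ⟨f i b, hf i b⟩

variable (hf : ∀ i c, cechD x' i (f i c) = f (i + 1) (cechD x i c))

/-- The map on Čech cohomology induced by a morphism of Čech complexes. -/
def cechCohomologyMap (i : ℕ) : CechCohomology x i →ₛₗ[σ] CechCohomology x' i :=
  Submodule.mapQ _ _
    ((f i).restrict (fun c hc => by
      rw [LinearMap.mem_ker] at hc ⊢
      rw [hf, hc, map_zero]))
    (fun _ h => map_mem_cechCoboundaries f hf h)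

theorem cechCohomologyMap_cechClass (i : ℕ) (c : LinearMap.ker (cechD x i)) :
    cechCohomologyMap f hf i (cechClass x i c) =
      cechClass x' i ⟨f i c.1, by rw [LinearMap.mem_ker, hf, c.2, map_zero]⟩ := rfl

theorem cechFrobenius_cechClass (p : ℕ) [Fact p.Prime] [CharP A p] (i : ℕ)
    (c : LinearMap.ker (cechD x i)) :
    cechFrobenius p x i (cechClass x i c) =
      cechClass x i ⟨cechFrobeniusCochain p x i c.1, by
        rw [LinearMap.mem_ker, cechD_frobenius, c.2, map_zero]⟩ := rfl

theorem cechCohomologyMap_cechFrobenius (p : ℕ) [Fact p.Prime] [CharP A p] [CharP A' p]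
    (hF : ∀ i c, f i (cechFrobeniusCochain p x i c) = cechFrobeniusCochain p x' i (f i c)) (i : ℕ)
    (z : CechCohomology x i) :
    cechCohomologyMap f hf i (cechFrobenius p x i z) =
      cechFrobenius p x' i (cechCohomologyMap f hf i z) := by
  obtain ⟨c, rfl⟩ := cechClass_surjective i z
  rw [cechFrobenius_cechClass, cechCohomologyMap_cechClass, cechCohomologyMap_cechClass,
    cechFrobenius_cechClass]
  simp only [hF]

end CohomologyMap

/-! ### Omitting members of the sequence that lie in the radical of the rest. -/

section Restrict

variable {A : Type*} [CommRing A] {s s' : ℕ} (ι : Fin s ↪o Fin s') (w : Fin s' → A)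

theorem isLocalizationAway_cechLoc_map (I : Finset (Fin s)) :
    IsLocalization.Away (∏ j ∈ I, (w ∘ ι) j) (CechLoc w (I.map ι.toEmbedding)) := by
  have : ∏ j ∈ I, (w ∘ ι) j = ∏ j ∈ I.map ι.toEmbedding, w j := by
    rw [Finset.prod_map]; rfl
  rw [this]
  infer_instance

/-- The localization at a product only depends on the product. -/
def cechLocMapEquiv (I : Finset (Fin s)) :
    CechLoc w (I.map ι.toEmbedding) ≃ₐ[A] CechLoc (w ∘ ι) I :=
  letI := isLocalizationAway_cechLoc_map ι w I
  IsLocalization.algEquiv (Submonoid.powers (∏ j ∈ I, (w ∘ ι) j)) _ _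

theorem cechLocMapEquiv_cechRes {I J : Finset (Fin s)} (h : I ⊆ J)
    (z : CechLoc w (I.map ι.toEmbedding)) :
    cechLocMapEquiv ι w J (cechRes w (Finset.map_subset_map.mpr h) z) =
      cechRes (w ∘ ι) h (cechLocMapEquiv ι w I z) := by
  have := isLocalizationAway_cechLoc_map ι w I
  have : (cechLocMapEquiv ι w J).toAlgHom.comp (cechRes w (Finset.map_subset_map.mpr h)) =
      (cechRes (w ∘ ι) h).comp (cechLocMapEquiv ι w I).toAlgHom :=
    IsLocalization.algHom_ext (Submonoid.powers (∏ j ∈ I, (w ∘ ι) j)) (by ext)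
  exact DFunLike.congr_fun this z

/-- The signs count smaller indices, which is why the embedding of index sets must preserve the
order. -/
theorem cechSign_map (J : Finset (Fin s)) (a : Fin s) :
    cechSign (J.map ι.toEmbedding) (ι a) = cechSign J a := by
  rw [cechSign, cechSign, Finset.filter_map, Finset.card_map]
  congr 3
  ext b
  exact ι.lt_iff_lt

theorem cechLocMapEquiv_cechTotalD (c : ∀ K, CechLoc w K) (J : Finset (Fin s)) :
    cechLocMapEquiv ι w J (cechTotalD w c (J.map ι.toEmbedding)) =
      cechTotalD (w ∘ ι) (fun I => cechLocMapEquiv ι w I (c (I.map ι.toEmbedding))) J := by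
  rw [cechTotalD_apply, cechTotalD_apply, map_sum]
  refine (Fintype.sum_equiv (Equiv.ofBijective (fun a : J => (⟨ι a.1, Finset.mem_map_of_mem _ a.2⟩ :
      {b // b ∈ J.map ι.toEmbedding}))
    ⟨fun a b h => Subtype.ext (ι.injective (congrArg Subtype.val h)),
      fun b => by
        obtain ⟨a, ha, h⟩ := Finset.mem_map.mp b.2
        exact ⟨⟨a, ha⟩, Subtype.ext h⟩⟩) _ _ fun a => ?_).symm
  rw [← cechLocMapEquiv_cechRes, map_zsmul]
  congr 1
  · exact (cechSign_map ι J a.1).symm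
  · congr 1
    exact cechRes_congr w c (Finset.map_erase ι.toEmbedding J a.1) _ _

/-- Restriction of Čech cochains along an embedding of index sets. -/
def cechRestrict (i : ℕ) : CechCochain w i →ₗ[A] CechCochain (w ∘ ι) i where
  toFun c I := cechLocMapEquiv ι w I.1
    (c ⟨I.1.map ι.toEmbedding, (Finset.card_map _).trans I.2⟩)
  map_add' c c' := by funext I; simp
  map_smul' a c := by funext I; simp

theorem cechExtend_cechRestrict {i : ℕ} (c : CechCochain w i) :
    cechExtend (w ∘ ι) i (cechRestrict ι w i c) =
      fun I => cechLocMapEquiv ι w I (cechExtend w i c (I.map ι.toEmbedding)) := by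
  funext I
  by_cases h : I.card = i
  · have h' : (I.map ι.toEmbedding).card = i := (Finset.card_map _).trans h
    rw [cechExtend_apply (w ∘ ι) (cechRestrict ι w i c) ⟨I, h⟩,
      cechExtend_apply w c ⟨I.map ι.toEmbedding, h'⟩]
    rfl
  · have h' : ¬ (I.map ι.toEmbedding).card = i := by rwa [Finset.card_map]
    rw [cechExtend, dif_neg h, cechExtend, dif_neg h', map_zero]

theorem cechExtend_injective {i : ℕ} : Function.Injective (cechExtend w i) := by
  intro c c' h
  funext I
  rw [← cechExtend_apply w c, h, cechExtend_apply]

theorem cechD_cechRestrict (i : ℕ) (c : CechCochain w i) :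
    cechD (w ∘ ι) i (cechRestrict ι w i c) = cechRestrict ι w (i + 1) (cechD w i c) := by
  apply cechExtend_injective
  rw [← cechTotalD_cechExtend, cechExtend_cechRestrict, cechExtend_cechRestrict,
    ← cechTotalD_cechExtend]
  funext J
  exact (cechLocMapEquiv_cechTotalD ι w _ J).symm

theorem exists_cechLocMapEquiv_eq (a : ∀ I, CechLoc (w ∘ ι) I) :
    ∃ c : ∀ K, CechLoc w K, ∀ I, cechLocMapEquiv ι w I (c (I.map ι.toEmbedding)) = a I := by
  have : ∀ K, ∃ v : CechLoc w K, ∀ (I : Finset (Fin s)) (h : K = I.map ι.toEmbedding),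
      cechLocMapEquiv ι w I (h ▸ v) = a I := by
    intro K
    by_cases h : ∃ I : Finset (Fin s), K = I.map ι.toEmbedding
    · obtain ⟨I, rfl⟩ := h
      refine ⟨(cechLocMapEquiv ι w I).symm (a I), fun I' h' => ?_⟩
      obtain rfl := Finset.map_injective _ h'
      exact AlgEquiv.apply_symm_apply _ _
    · exact ⟨0, fun I hI => (h ⟨I, hI⟩).elim⟩
  choose c hc using this
  exact ⟨c, fun I => hc _ I rfl⟩

/-- The members of a sequence in the radical of the ideal generated by a subsequence can be
omitted in Čech cohomology. -/
theorem bijective_cechCohomologyMap_cechRestrict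
    (hw : ∀ q, w q ∈ (Ideal.span (Set.range (w ∘ ι))).radical) (i : ℕ) :
    Function.Bijective
      (cechCohomologyMap (cechRestrict ι w) (cechD_cechRestrict ι w) i) := by
  let P : Finset (Fin s') := Finset.univ.map ι.toEmbedding
  have hP : ∀ q, w q ∈ (Ideal.span (w '' P)).radical := by
    have : w '' P = Set.range (w ∘ ι) := by
      rw [Set.range_comp]
      congr 1
      simp [P]
    rwa [this]
  have hsub : ∀ K ⊆ P, ∃ I : Finset (Fin s), K = I.map ι.toEmbedding := fun K hK => by
    obtain ⟨I, -, hI⟩ := Finset.subset_map_iff.mp hK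
    exact ⟨I, hI⟩
  constructor
  · rw [injective_iff_map_eq_zero]
    intro z hz
    obtain ⟨⟨c, hc⟩, rfl⟩ := cechClass_surjective i z
    rw [LinearMap.mem_ker] at hc
    rw [cechCohomologyMap_cechClass, cechClass_eq_zero_iff] at hz
    rw [cechClass_eq_zero_iff]
    have hc' : cechTotalD w (cechExtend w i c) = 0 := by
      rw [cechTotalD_cechExtend, hc]; funext I; simp [cechExtend]
    cases i with
    | zero =>
      have h0 : cechRestrict ι w 0 c = 0 := hz
      change c = 0
      funext ⟨I, hI⟩
      obtain rfl := Finset.card_eq_zero.mp hI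
      have h1 := congrFun h0 ⟨∅, rfl⟩
      exact (map_eq_zero_iff _ (cechLocMapEquiv ι w ∅).injective).mp h1
    | succ i =>
      obtain ⟨a, ha⟩ := hz
      -- A primitive `a` of the restricted cocycle is lifted to `a'`; then `c - d a'` vanishes on
      -- the subsets of `P` and acyclicity provides its primitive.
      obtain ⟨a', ha'⟩ := exists_cechLocMapEquiv_eq ι w (cechExtend (w ∘ ι) i a)
      have h0 : ∀ K ⊆ P, (cechExtend w (i + 1) c - cechTotalD w a') K = 0 := by
        intro K hK
        obtain ⟨J, rfl⟩ := hsub K hK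
        apply (cechLocMapEquiv ι w J).injective
        rw [Pi.sub_apply, map_sub, map_zero, cechLocMapEquiv_cechTotalD, funext ha',
          cechTotalD_cechExtend, ha, sub_eq_zero]
        exact (congrFun (cechExtend_cechRestrict ι w c) J).symm
      obtain ⟨b, hb, -⟩ := exists_cechTotalD_eq w hP
        (by rw [map_sub, hc', cechTotalD_cechTotalD, sub_zero]) h0
      -- The primitive may have components in every cardinality; only those of cardinality `i` enter
      -- the differential in degree `i + 1`.
      refine ⟨fun I => (b + a') I.1, ?_⟩
      funext J
      change cechTotalD w (b + a') J.1 = c J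
      rw [map_add, hb, sub_add_cancel, cechExtend_apply]
  · intro z
    obtain ⟨⟨a, ha⟩, rfl⟩ := cechClass_surjective i z
    rw [LinearMap.mem_ker] at ha
    obtain ⟨a', ha'⟩ := exists_cechLocMapEquiv_eq ι w (cechExtend (w ∘ ι) i a)
    have h0 : ∀ K ⊆ P, cechTotalD w a' K = 0 := by
      intro K hK
      obtain ⟨J, rfl⟩ := hsub K hK
      apply (cechLocMapEquiv ι w J).injective
      rw [map_zero, cechLocMapEquiv_cechTotalD, funext ha', cechTotalD_cechExtend, ha]
      simp [cechExtend]
    -- The lift `a'` need not be a cocycle. Its differential vanishes on subsets of `P`, so it is `d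
    -- b` with `b` zero on subsets of `P`, and `a' - b` is a cocycle with the same restriction.
    obtain ⟨b, hb, hb0⟩ := exists_cechTotalD_eq w hP (cechTotalD_cechTotalD w a') h0
    refine ⟨cechClass w i ⟨fun I => (a' - b) I.1, ?_⟩, ?_⟩
    · rw [LinearMap.mem_ker]
      funext J
      change cechTotalD w (a' - b) J.1 = 0
      rw [map_sub, hb, sub_self]
      rfl
    · rw [cechCohomologyMap_cechClass]
      congr 1
      apply Subtype.ext
      funext I
      change cechLocMapEquiv ι w I.1 ((a' - b) (I.1.map ι.toEmbedding)) = a I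
      rw [Pi.sub_apply, hb0 _ (Finset.map_subset_map.mpr (Finset.subset_univ _)), sub_zero, ha',
        cechExtend_apply]

end Restrict

/-! ### Independence of the sequence, and vanishing above the dimension. -/

section Independence

variable (p : ℕ) [Fact p.Prime] {A : Type*} [CommRing A] [CharP A p] {s t : ℕ}

theorem exists_cechCohomology_equiv_of_comp_eq (ι : Fin s ↪o Fin t) {w : Fin t → A}
    {x : Fin s → A} (hx : w ∘ ι = x) (hw : ∀ q, w q ∈ (Ideal.span (Set.range x)).radical) (i : ℕ) :
    ∃ E : CechCohomology w i ≃ₗ[A] CechCohomology x i,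
      ∀ z, E (cechFrobenius p w i z) = cechFrobenius p x i (E z) := by
  subst hx
  refine ⟨LinearEquiv.ofBijective _ (bijective_cechCohomologyMap_cechRestrict ι w hw i),
    fun z => cechCohomologyMap_cechFrobenius _ (cechD_cechRestrict ι w) p (fun i c => ?_) i z⟩
  funext I
  exact map_pow (cechLocMapEquiv ι w I.1) _ p

/-- Čech cohomology with its Frobenius action only depends on the radical of the ideal generated
by the sequence. -/
theorem exists_cechCohomology_equiv {x : Fin s → A} {y : Fin t → A}
    (hx : ∀ j, x j ∈ (Ideal.span (Set.range y)).radical)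
    (hy : ∀ j, y j ∈ (Ideal.span (Set.range x)).radical) (i : ℕ) :
    ∃ E : CechCohomology x i ≃ₗ[A] CechCohomology y i,
      ∀ z, E (cechFrobenius p x i z) = cechFrobenius p y i (E z) := by
  -- Both sequences are compared with their concatenation, from which either half can be omitted.
  obtain ⟨E, hE⟩ := exists_cechCohomology_equiv_of_comp_eq p (Fin.castAddOrderEmb t)
    (w := Fin.append x y) (x := x) (by funext j; simp) (fun q => by
      induction q using Fin.addCases with
      | left q => rw [Fin.append_left]; exact Ideal.le_radical (Ideal.subset_span ⟨q, rfl⟩)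
      | right q => rw [Fin.append_right]; exact hy q) i
  obtain ⟨E', hE'⟩ := exists_cechCohomology_equiv_of_comp_eq p (Fin.natAddOrderEmb s)
    (w := Fin.append x y) (x := y) (by funext j; simp) (fun q => by
      induction q using Fin.addCases with
      | left q => rw [Fin.append_left]; exact hx q
      | right q => rw [Fin.append_right]; exact Ideal.le_radical (Ideal.subset_span ⟨q, rfl⟩)) i
  refine ⟨E.symm.trans E', fun z => ?_⟩
  obtain ⟨z, rfl⟩ := E.surjective z
  rw [← hE]
  simp [hE']

theorem subsingleton_cechCohomology_of_lt (x : Fin s → A) {i : ℕ} (hi : s < i) :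
    Subsingleton (CechCohomology x i) := by
  have : IsEmpty {I : Finset (Fin s) // I.card = i} :=
    ⟨fun I => by have := card_finset_fin_le I.1; have := I.2; omega⟩
  exact (cechClass_surjective (x := x) i).subsingleton

end Independence

/-- Local cohomology vanishes above the dimension. -/
theorem subsingleton_localCoh (p : ℕ) [Fact p.Prime] {A : Type*} [CommRing A] [CharP A p]
    [IsNoetherianRing A] [IsLocalRing A] {i : ℕ}
    (hi : ringKrullDim A < i) : Subsingleton (LocalCoh A i) := by
  -- The maximal ideal is minimal over an ideal generated by as many elements as its height. A Čech
  -- complex on that many elements has no terms above the dimension.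
  obtain ⟨S, hS, hcard⟩ :=
    Ideal.exists_finset_card_eq_height_of_isNoetherianRing (IsLocalRing.maximalIdeal A)
  have hlt : S.card < i := by
    rw [← IsLocalRing.maximalIdeal_height_eq_ringKrullDim, ← hcard] at hi
    exact_mod_cast hi
  let y : Fin S.card → A := fun j => (S.equivFin.symm j : A)
  have hy : Set.range y = S := by
    change Set.range (Subtype.val ∘ S.equivFin.symm) = S
    rw [Set.range_comp, S.equivFin.symm.range_eq_univ]
    simp
  have hrad : (Ideal.span (Set.range y)).radical = IsLocalRing.maximalIdeal A := by
    rw [hy, Ideal.radical_eq_sInf]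
    refine le_antisymm (sInf_le ⟨hS.1.2, inferInstance⟩) (le_sInf ?_)
    rintro q ⟨hq, hqp⟩
    exact hS.2 ⟨hqp, hq⟩ (IsLocalRing.le_maximalIdeal hqp.ne_top)
  have hg := span_idealGens (IsLocalRing.maximalIdeal A)
  obtain ⟨E, -⟩ := exists_cechCohomology_equiv p
    (x := idealGens (IsLocalRing.maximalIdeal A)) (y := y)
    (fun j => hrad.ge <| hg.le (Ideal.subset_span ⟨j, rfl⟩))
    (fun j => by
      rw [hg]
      exact Ideal.le_radical (hrad.le (Ideal.le_radical (Ideal.subset_span ⟨j, rfl⟩)))) i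
  have := subsingleton_cechCohomology_of_lt y hlt
  exact E.injective.subsingleton

/-! ### Čech cohomology under ring maps; `m = n` serves the Veronese subring, `m = 1` a
localization. -/

section RingHom

variable {A A' : Type*} [CommRing A] [CommRing A'] (φ : A →+* A') {s : ℕ} {x : Fin s → A}
  {x' : Fin s → A'} {m : ℕ} (h : ∀ j, φ (x j) = x' j ^ m)

theorem map_prod_eq_pow (h : ∀ j, φ (x j) = x' j ^ m) (I : Finset (Fin s)) :
    φ (∏ j ∈ I, x j) = (∏ j ∈ I, x' j) ^ m := by
  rw [map_prod, ← Finset.prod_pow]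
  exact Finset.prod_congr rfl fun j _ => h j

theorem isUnit_algebraMap_map_prod (h : ∀ j, φ (x j) = x' j ^ m) (I : Finset (Fin s)) :
    IsUnit (((algebraMap A' (CechLoc x' I)).comp φ) (∏ j ∈ I, x j)) := by
  rw [RingHom.comp_apply, map_prod_eq_pow φ h, map_pow]
  exact (isUnit_cechLoc x' (Finset.Subset.refl I)).pow m

/-- The ring homomorphism `A_{x_I} → A'_{x'_I}` induced by `φ : A → A'`, if `φ` maps each `x_j` to
a power of `x'_j`. -/
def cechLocMap (I : Finset (Fin s)) : CechLoc x I →+* CechLoc x' I :=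
  IsLocalization.Away.lift (∏ j ∈ I, x j) (isUnit_algebraMap_map_prod φ h I)

theorem cechLocMap_algebraMap (I : Finset (Fin s)) (a : A) :
    cechLocMap φ h I (algebraMap A _ a) = algebraMap A' _ (φ a) :=
  IsLocalization.Away.lift_eq _ _ a

theorem cechLocMap_smul (I : Finset (Fin s)) (a : A) (z : CechLoc x I) :
    cechLocMap φ h I (a • z) = φ a • cechLocMap φ h I z := by
  rw [Algebra.smul_def, map_mul, cechLocMap_algebraMap, Algebra.smul_def]

theorem cechLocMap_cechRes {I J : Finset (Fin s)} (hIJ : I ⊆ J) (z : CechLoc x I) :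
    cechLocMap φ h J (cechRes x hIJ z) = cechRes x' hIJ (cechLocMap φ h I z) := by
  have : (cechLocMap φ h J).comp (cechRes x hIJ).toRingHom =
      (cechRes x' hIJ).toRingHom.comp (cechLocMap φ h I) := by
    refine IsLocalization.ringHom_ext (Submonoid.powers (∏ j ∈ I, x j)) (RingHom.ext fun a => ?_)
    change cechLocMap φ h J (cechRes x hIJ (algebraMap A _ a)) =
      cechRes x' hIJ (cechLocMap φ h I (algebraMap A _ a))
    rw [AlgHom.commutes, cechLocMap_algebraMap, cechLocMap_algebraMap, AlgHom.commutes]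
  exact DFunLike.congr_fun this z

/-- The map of Čech cochains induced by a ring homomorphism. -/
def cechCochainMap (i : ℕ) : CechCochain x i →ₛₗ[φ] CechCochain x' i where
  toFun c I := cechLocMap φ h I.1 (c I)
  map_add' c c' := by funext I; exact map_add _ _ _
  map_smul' a c := by funext I; exact cechLocMap_smul φ h I.1 a (c I)

theorem cechD_cechCochainMap (i : ℕ) (c : CechCochain x i) :
    cechD x' i (cechCochainMap φ h i c) = cechCochainMap φ h (i + 1) (cechD x i c) := by
  funext J
  change _ = cechLocMap φ h J.1 (cechD x i c J)
  rw [cechD_apply, cechD_apply, map_sum]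
  refine Finset.sum_congr rfl fun a _ => ?_
  rw [map_zsmul, cechLocMap_cechRes]
  rfl

theorem cechCochainMap_cechFrobeniusCochain (p : ℕ) [Fact p.Prime] [CharP A p] [CharP A' p] (i : ℕ)
    (c : CechCochain x i) :
    cechCochainMap φ h i (cechFrobeniusCochain p x i c) =
      cechFrobeniusCochain p x' i (cechCochainMap φ h i c) := by
  funext I
  exact map_pow (cechLocMap φ h I.1) _ p

/-- The map on Čech cohomology induced by a ring homomorphism. -/
abbrev cechCohomologyRingMap (i : ℕ) : CechCohomology x i →ₛₗ[φ] CechCohomology x' i :=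
  cechCohomologyMap (cechCochainMap φ h) (cechD_cechCochainMap φ h) i

theorem isUnit_algebraMap_prod_pow (x : Fin s → A) (I : Finset (Fin s)) (N : ℕ) :
    IsUnit (algebraMap A (CechLoc x I) ((∏ j ∈ I, x j) ^ N)) := by
  rw [map_pow]
  exact (isUnit_cechLoc x (Finset.Subset.refl I)).pow N

theorem exists_mul_algebraMap_prod_pow_eq (x : Fin s → A) {I : Finset (Fin s)} (z : CechLoc x I) :
    ∃ (N : ℕ) (a : A), z * algebraMap A _ ((∏ j ∈ I, x j) ^ N) = algebraMap A _ a := by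
  obtain ⟨N, a, h⟩ := IsLocalization.Away.surj (∏ j ∈ I, x j) z
  exact ⟨N, a, by rw [map_pow]; exact h⟩

theorem exists_mul_algebraMap_prod_pow_eq' (x : Fin s → A) (I : Finset (Fin s)) (N : ℕ) (a : A) :
    ∃ z : CechLoc x I, z * algebraMap A _ ((∏ j ∈ I, x j) ^ N) = algebraMap A _ a := by
  obtain ⟨v, hv⟩ := (isUnit_algebraMap_prod_pow x I N).exists_left_inv
  exact ⟨algebraMap A _ a * v, by rw [mul_assoc, hv, mul_one]⟩

theorem exists_prod_pow_mul_eq_zero (x : Fin s → A) {I : Finset (Fin s)} {a : A}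
    (ha : algebraMap A (CechLoc x I) a = 0) : ∃ N : ℕ, (∏ j ∈ I, x j) ^ N * a = 0 := by
  obtain ⟨N, hN⟩ := IsLocalization.Away.exists_of_eq (∏ j ∈ I, x j) (ha.trans (map_zero _).symm)
  exact ⟨N, by rw [hN, mul_zero]⟩

theorem cechLocMap_mul_algebraMap_prod_pow {I : Finset (Fin s)} {z : CechLoc x I} {N : ℕ} {a : A}
    (hz : z * algebraMap A _ ((∏ j ∈ I, x j) ^ N) = algebraMap A _ a) :
    cechLocMap φ h I z * algebraMap A' _ ((∏ j ∈ I, x' j) ^ (m * N)) = algebraMap A' _ (φ a) := by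
  have hN : φ ((∏ j ∈ I, x j) ^ N) = (∏ j ∈ I, x' j) ^ (m * N) := by
    rw [map_pow, map_prod_eq_pow φ h, ← pow_mul]
  rw [← cechLocMap_algebraMap φ h, ← hz, map_mul, cechLocMap_algebraMap, hN]

theorem cechLocMap_injective (hm : m ≠ 0) (hφ : Function.Injective φ) (I : Finset (Fin s)) :
    Function.Injective (cechLocMap φ h I) := by
  rw [injective_iff_map_eq_zero]
  intro z hz
  obtain ⟨N, a, ha⟩ := exists_mul_algebraMap_prod_pow_eq x z
  have h0 := cechLocMap_mul_algebraMap_prod_pow φ h ha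
  rw [hz, zero_mul] at h0
  obtain ⟨M, hM⟩ := exists_prod_pow_mul_eq_zero x' h0.symm
  have h1 : (∏ j ∈ I, x j) ^ M * a = 0 := by
    apply hφ
    -- As `m ≥ 1`, the power `x'_I ^ (m M) = φ (x_I ^ M)` is a multiple of `x'_I ^ M`, which kills
    -- `φ a`.
    obtain ⟨m', rfl⟩ := Nat.exists_eq_succ_of_ne_zero hm
    rw [map_mul, map_pow, map_prod_eq_pow φ h, map_zero, pow_succ, mul_pow, mul_assoc, hM,
      mul_zero]
  apply (isUnit_algebraMap_prod_pow x I N).mul_left_injective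
  apply (isUnit_algebraMap_prod_pow x I M).mul_left_injective
  simp only [zero_mul]
  rw [ha, ← map_mul, mul_comm a, h1, map_zero]

theorem cechCochainMap_injective (hm : m ≠ 0) (hφ : Function.Injective φ) (i : ℕ) :
    Function.Injective (cechCochainMap φ h i) := fun _ _ hc =>
  funext fun I => cechLocMap_injective φ h hm hφ I.1 (congrFun hc I)

end RingHom

/-! ### Čech cohomology commutes with localization of the base ring. -/

section Localization

variable {A : Type*} [CommRing A] (M : Submonoid A) (A' : Type*) [CommRing A'] [Algebra A A']
  [IsLocalization M A'] {s : ℕ} {x : Fin s → A} {x' : Fin s → A'}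
  (h : ∀ j, algebraMap A A' (x j) = x' j ^ 1)

theorem exists_smul_eq_cechLocMap {I : Finset (Fin s)} (z : CechLoc x' I) :
    ∃ u ∈ M, ∃ z', algebraMap A A' u • z = cechLocMap (algebraMap A A') h I z' := by
  obtain ⟨N, b, hb⟩ := exists_mul_algebraMap_prod_pow_eq x' z
  obtain ⟨⟨a, u⟩, hu⟩ := IsLocalization.surj M b
  obtain ⟨z', hz'⟩ := exists_mul_algebraMap_prod_pow_eq' x I N a
  refine ⟨u, u.2, z', ?_⟩
  have h1 := cechLocMap_mul_algebraMap_prod_pow (algebraMap A A') h hz'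
  apply (isUnit_algebraMap_prod_pow x' I (1 * N)).mul_left_injective
  simp only
  rw [h1, one_mul, Algebra.smul_def, mul_assoc, hb, ← map_mul, mul_comm, hu]

theorem exists_smul_eq_zero_of_cechLocMap {I : Finset (Fin s)} {z : CechLoc x I}
    (hz : cechLocMap (algebraMap A A') h I z = 0) : ∃ u ∈ M, u • z = 0 := by
  obtain ⟨N, a, ha⟩ := exists_mul_algebraMap_prod_pow_eq x z
  have h0 := cechLocMap_mul_algebraMap_prod_pow (algebraMap A A') h ha
  rw [hz, zero_mul] at h0
  obtain ⟨K, hK⟩ := exists_prod_pow_mul_eq_zero x' h0.symm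
  have h1 : algebraMap A A' ((∏ j ∈ I, x j) ^ K * a) = algebraMap A A' 0 := by
    rw [map_mul, map_pow, map_prod_eq_pow _ h, pow_one, hK, map_zero]
  obtain ⟨u, hu⟩ := (IsLocalization.eq_iff_exists M A').mp h1
  refine ⟨u, u.2, ?_⟩
  apply (isUnit_algebraMap_prod_pow x I N).mul_left_injective
  apply (isUnit_algebraMap_prod_pow x I K).mul_left_injective
  simp only [zero_mul]
  rw [smul_mul_assoc, ha, Algebra.smul_def, ← map_mul, ← map_mul]
  rw [mul_zero] at hu
  rw [mul_assoc, mul_comm a, hu, map_zero]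

theorem exists_smul_eq_cechCochainMap {i : ℕ} (c : CechCochain x' i) :
    ∃ u ∈ M, ∃ c', algebraMap A A' u • c = cechCochainMap (algebraMap A A') h i c' := by
  classical
  choose u hu z hz using fun I => exists_smul_eq_cechLocMap M A' h (c I)
  refine ⟨∏ I, u I, M.prod_mem fun I _ => hu I,
    fun I => (∏ J ∈ Finset.univ.erase I, u J) • z I, ?_⟩
  funext I
  change algebraMap A A' (∏ I, u I) • c I =
    cechLocMap (algebraMap A A') h I.1 ((∏ J ∈ Finset.univ.erase I, u J) • z I)
  rw [cechLocMap_smul, ← hz, smul_smul, ← map_mul, Finset.prod_erase_mul _ _ (Finset.mem_univ I)]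

theorem exists_smul_eq_zero_of_cechCochainMap {i : ℕ} {c : CechCochain x i}
    (hc : cechCochainMap (algebraMap A A') h i c = 0) : ∃ u ∈ M, u • c = 0 := by
  classical
  choose u hu hz using fun I => exists_smul_eq_zero_of_cechLocMap M A' h (congrFun hc I)
  refine ⟨∏ I, u I, M.prod_mem fun I _ => hu I, ?_⟩
  funext I
  rw [Pi.smul_apply, ← Finset.prod_erase_mul _ _ (Finset.mem_univ I), mul_smul, hz, smul_zero]
  rfl

/-- Together with the next lemma this expresses that the cohomology over `A'` is the localization of
the cohomology over `A`. Common denominators exist because a cochain has finitely many components.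
-/
theorem exists_smul_eq_cechCohomologyRingMap {i : ℕ} (z : CechCohomology x' i) :
    ∃ u ∈ M, ∃ y, algebraMap A A' u • z = cechCohomologyRingMap (algebraMap A A') h i y := by
  obtain ⟨⟨c, hc⟩, rfl⟩ := cechClass_surjective i z
  rw [LinearMap.mem_ker] at hc
  obtain ⟨u, hu, c', hc'⟩ := exists_smul_eq_cechCochainMap M A' h c
  have h0 : cechCochainMap (algebraMap A A') h (i + 1) (cechD x i c') = 0 := by
    rw [← cechD_cechCochainMap, ← hc', map_smul, hc, smul_zero]
  -- The numerator `c'` is a cocycle only after localization; a second factor `v` makes it one over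
  -- `A`.
  obtain ⟨v, hv, hvc⟩ := exists_smul_eq_zero_of_cechCochainMap M A' h h0
  refine ⟨v * u, M.mul_mem hv hu,
    cechClass x i ⟨v • c', by rw [LinearMap.mem_ker, map_smul, hvc]⟩, ?_⟩
  rw [cechCohomologyMap_cechClass, ← map_smul]
  congr 1
  apply Subtype.ext
  change algebraMap A A' (v * u) • c = cechCochainMap (algebraMap A A') h i (v • c')
  rw [map_smulₛₗ, ← hc', smul_smul, map_mul]

theorem exists_smul_eq_zero_of_cechCohomologyRingMap {i : ℕ} {z : CechCohomology x i}
    (hz : cechCohomologyRingMap (algebraMap A A') h i z = 0) : ∃ u ∈ M, u • z = 0 := by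
  obtain ⟨⟨c, hc⟩, rfl⟩ := cechClass_surjective i z
  rw [cechCohomologyMap_cechClass, cechClass_eq_zero_iff] at hz
  suffices H : ∃ u ∈ M, u • c ∈ cechCoboundaries x i by
    obtain ⟨u, hu, huc⟩ := H
    exact ⟨u, hu, by rw [← map_smul, cechClass_eq_zero_iff]; exact huc⟩
  cases i with
  | zero =>
    obtain ⟨u, hu, huc⟩ := exists_smul_eq_zero_of_cechCochainMap M A' h hz
    exact ⟨u, hu, huc⟩
  | succ i =>
    obtain ⟨b, hb⟩ := hz
    obtain ⟨u, hu, b', hb'⟩ := exists_smul_eq_cechCochainMap M A' h b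
    have h0 : cechCochainMap (algebraMap A A') h (i + 1) (u • c - cechD x i b') = 0 := by
      rw [map_sub, map_smulₛₗ, ← cechD_cechCochainMap, ← hb', map_smul, hb, sub_self]
    obtain ⟨v, hv, hvc⟩ := exists_smul_eq_zero_of_cechCochainMap M A' h h0
    refine ⟨v * u, M.mul_mem hv hu, v • b', ?_⟩
    rw [map_smul, mul_smul, eq_comm, ← sub_eq_zero, ← smul_sub, hvc]

end Localization

/-! ### The grading encoded as a ring homomorphism to Laurent polynomials. -/

section Coaction

variable {k : Type*} [Field k] {R : Type*} [CommRing R] [Algebra k R] (𝒜 : ℕ → Submodule k R)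
  [GradedAlgebra 𝒜]

/-- For an `R`-algebra `S`, the ring homomorphism `R → S[T;T⁻¹]` that sends `r` of degree `d` to
`r T ^ d`. -/
def gradedCoaction (S : Type*) [CommRing S] [Algebra R S] : R →+* AddMonoidAlgebra S ℤ :=
  (DirectSum.toSemiring (A := fun d => 𝒜 d)
    (fun d => ((AddMonoidAlgebra.singleAddHom (d : ℤ)).comp (algebraMap R S).toAddMonoidHom).comp
      (𝒜 d).subtype.toAddMonoidHom)
    (by
      change AddMonoidAlgebra.single ((0 : ℕ) : ℤ) (algebraMap R S (1 : R)) = 1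
      rw [map_one]; rfl)
    (fun {d d'} a b => by
      change AddMonoidAlgebra.single ((d + d' : ℕ) : ℤ) (algebraMap R S ((a : R) * (b : R))) =
        AddMonoidAlgebra.single (d : ℤ) (algebraMap R S a) *
          AddMonoidAlgebra.single (d' : ℤ) (algebraMap R S b)
      rw [AddMonoidAlgebra.single_mul_single, map_mul, Nat.cast_add])).comp
    (DirectSum.decomposeRingEquiv 𝒜).toRingHom

variable (S : Type*) [CommRing S] [Algebra R S]

theorem gradedCoaction_of_mem {d : ℕ} {r : R} (hr : r ∈ 𝒜 d) :
    gradedCoaction 𝒜 S r = AddMonoidAlgebra.single (d : ℤ) (algebraMap R S r) := by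
  have h : (DirectSum.decomposeRingEquiv 𝒜).toRingHom r = DirectSum.of (fun d => 𝒜 d) d ⟨r, hr⟩ :=
    DirectSum.decompose_of_mem 𝒜 hr
  rw [gradedCoaction, RingHom.comp_apply, h, DirectSum.toSemiring_of]
  rfl

theorem gradedCoaction_of_mem_intPiece {m : ℤ} {r : R} (hr : r ∈ intPiece 𝒜 m) :
    gradedCoaction 𝒜 S r = AddMonoidAlgebra.single m (algebraMap R S r) := by
  cases m with
  | ofNat d => exact gradedCoaction_of_mem 𝒜 S hr
  | negSucc d =>
    have h0 : r = 0 := hr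
    rw [h0, map_zero, map_zero, AddMonoidAlgebra.single_zero]

/-- This is what makes the coefficients of the coaction on `R_{x_I}` homogeneous fractions in the
sense of `cechLocPiece`. -/
theorem exists_coeff_gradedCoaction (r : R) (m : ℤ) :
    ∃ r' ∈ intPiece 𝒜 m, (gradedCoaction 𝒜 S r).coeff m = algebraMap R S r' := by
  induction r using DirectSum.Decomposition.inductionOn 𝒜 with
  | zero => exact ⟨0, zero_mem _, by simp⟩
  | @homogeneous d r =>
    rw [gradedCoaction_of_mem 𝒜 S r.2, AddMonoidAlgebra.coeff_single, Finsupp.single_apply]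
    split_ifs with h
    · exact ⟨r, h ▸ r.2, rfl⟩
    · exact ⟨0, zero_mem _, (map_zero _).symm⟩
  | add r r' h h' =>
    obtain ⟨a, ha, e⟩ := h
    obtain ⟨b, hb, e'⟩ := h'
    exact ⟨a + b, add_mem ha hb, by
      rw [map_add, AddMonoidAlgebra.coeff_add, Finsupp.add_apply, e, e', map_add]⟩

theorem coeff_gradedCoaction_of_mem_veronese {n : ℕ} {a : R} (ha : a ∈ veronese 𝒜 n) {m : ℤ}
    (hm : ¬ (n : ℤ) ∣ m) : (gradedCoaction 𝒜 S a).coeff m = 0 := by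
  have ha' : a ∈ ⨆ t : ℕ, 𝒜 (n * t) := ha
  clear ha
  induction ha' using Submodule.iSup_induction' with
  | mem t a hat =>
    rw [gradedCoaction_of_mem 𝒜 S hat, AddMonoidAlgebra.coeff_single, Finsupp.single_apply, if_neg]
    rintro rfl
    exact hm ⟨t, by push_cast; ring⟩
  | zero => simp
  | add a b _ _ iha ihb =>
    rw [map_add, AddMonoidAlgebra.coeff_add, Finsupp.add_apply, iha, ihb, add_zero]

end Coaction

/-! ### Homogeneous components of fractions, cochains and cohomology classes. -/

section Projection

variable {k : Type*} [Field k] {R : Type*} [CommRing R] [Algebra k R] (𝒜 : ℕ → Submodule k R)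
  [GradedAlgebra 𝒜] {s : ℕ} (x : Fin s → R) (e : Fin s → ℕ) (hx : ∀ j, x j ∈ 𝒜 (e j))

theorem coeff_mul_single_add {S : Type*} [CommRing S] (f : AddMonoidAlgebra S ℤ) (a : S)
    (m d : ℤ) : (f * AddMonoidAlgebra.single d a).coeff (m + d) = f.coeff m * a :=
  AddMonoidAlgebra.coeff_mul_single_eq_coeff_mul _ (fun _ _ => by simp)

theorem prod_pow_mem (hx : ∀ j, x j ∈ 𝒜 (e j)) (I : Finset (Fin s)) (N : ℕ) :
    (∏ j ∈ I, x j) ^ N ∈ 𝒜 (N * ∑ j ∈ I, e j) :=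
  SetLike.pow_mem_graded N (SetLike.prod_mem_graded 𝒜 e x fun j _ => hx j)

theorem isUnit_single {S : Type*} [CommRing S] (d : ℤ) {a : S} (ha : IsUnit a) :
    IsUnit (AddMonoidAlgebra.single d a) := by
  obtain ⟨b, hb⟩ := ha.exists_right_inv
  refine IsUnit.of_mul_eq_one (AddMonoidAlgebra.single (-d) b) ?_
  rw [AddMonoidAlgebra.single_mul_single, hb, add_neg_cancel]
  rfl

theorem gradedCoaction_prod_pow (S : Type*) [CommRing S] [Algebra R S]
    (hx : ∀ j, x j ∈ 𝒜 (e j)) (I : Finset (Fin s)) (N : ℕ) :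
    gradedCoaction 𝒜 S ((∏ j ∈ I, x j) ^ N) = AddMonoidAlgebra.single
      (N * ∑ j ∈ I, (e j : ℤ)) (algebraMap R S ((∏ j ∈ I, x j) ^ N)) := by
  rw [gradedCoaction_of_mem 𝒜 _ (prod_pow_mem 𝒜 x e hx I N)]
  push_cast
  rfl

/-- The coaction `R_{x_I} → R_{x_I}[T;T⁻¹]` that encodes the `ℤ`-grading. -/
def cechLocCoaction (I : Finset (Fin s)) : CechLoc x I →+* AddMonoidAlgebra (CechLoc x I) ℤ :=
  IsLocalization.Away.lift (∏ j ∈ I, x j) (g := gradedCoaction 𝒜 (CechLoc x I)) (by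
    have h := gradedCoaction_prod_pow 𝒜 x e (CechLoc x I) hx I 1
    have h' := isUnit_single (1 * ∑ j ∈ I, (e j : ℤ)) (isUnit_algebraMap_prod_pow x I 1)
    rw [Nat.cast_one] at h
    rw [← h, pow_one] at h'
    exact h')

theorem cechLocCoaction_algebraMap (I : Finset (Fin s)) (r : R) :
    cechLocCoaction 𝒜 x e hx I (algebraMap R _ r) = gradedCoaction 𝒜 (CechLoc x I) r :=
  IsLocalization.Away.lift_eq _ _ r

theorem cechLocCoaction_mul_single {I : Finset (Fin s)} {z : CechLoc x I} {N : ℕ} {r : R}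
    (hz : z * algebraMap R _ ((∏ j ∈ I, x j) ^ N) = algebraMap R _ r) :
    cechLocCoaction 𝒜 x e hx I z * AddMonoidAlgebra.single (N * ∑ j ∈ I, (e j : ℤ))
      (algebraMap R _ ((∏ j ∈ I, x j) ^ N)) = gradedCoaction 𝒜 (CechLoc x I) r := by
  rw [← gradedCoaction_prod_pow 𝒜 x e _ hx, ← cechLocCoaction_algebraMap 𝒜 x e hx, ← map_mul, hz,
    cechLocCoaction_algebraMap]

/-- Both sides agree after multiplication by the coaction of the denominator, which is a monomial
with unit coefficient and can be cancelled. -/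
theorem cechLocCoaction_of_mem {I : Finset (Fin s)} {m : ℤ} {z : CechLoc x I}
    (hz : z ∈ cechLocPiece 𝒜 x e hx I m) :
    cechLocCoaction 𝒜 x e hx I z = AddMonoidAlgebra.single m z := by
  obtain ⟨N, r, hr, h⟩ := hz
  have h1 := cechLocCoaction_mul_single 𝒜 x e hx h
  rw [gradedCoaction_of_mem_intPiece 𝒜 _ hr, ← h, ← AddMonoidAlgebra.single_mul_single] at h1
  exact (isUnit_single _ (isUnit_algebraMap_prod_pow x I N)).mul_left_injective h1

/-- The projection of `R_{x_I}` onto its degree `m` part. -/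
def cechLocProj (I : Finset (Fin s)) (m : ℤ) : CechLoc x I →+ CechLoc x I where
  toFun z := (cechLocCoaction 𝒜 x e hx I z).coeff m
  map_zero' := by simp
  map_add' z w := by rw [map_add, AddMonoidAlgebra.coeff_add, Finsupp.add_apply]

theorem cechLocProj_of_mem {I : Finset (Fin s)} {m m' : ℤ} {z : CechLoc x I}
    (hz : z ∈ cechLocPiece 𝒜 x e hx I m) :
    cechLocProj 𝒜 x e hx I m' z = if m = m' then z else 0 := by
  change (cechLocCoaction 𝒜 x e hx I z).coeff m' = _
  rw [cechLocCoaction_of_mem 𝒜 x e hx hz, AddMonoidAlgebra.coeff_single, Finsupp.single_apply]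

theorem cechLocProj_mul {I : Finset (Fin s)} (m : ℤ) {z : CechLoc x I} {N : ℕ} {r : R}
    (hz : z * algebraMap R _ ((∏ j ∈ I, x j) ^ N) = algebraMap R _ r) :
    cechLocProj 𝒜 x e hx I m z * algebraMap R _ ((∏ j ∈ I, x j) ^ N) =
      (gradedCoaction 𝒜 (CechLoc x I) r).coeff (m + N * ∑ j ∈ I, (e j : ℤ)) := by
  rw [← cechLocCoaction_mul_single 𝒜 x e hx hz, coeff_mul_single_add]
  rfl

theorem cechLocProj_mem (I : Finset (Fin s)) (m : ℤ) (z : CechLoc x I) :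
    cechLocProj 𝒜 x e hx I m z ∈ cechLocPiece 𝒜 x e hx I m := by
  obtain ⟨N, r, h⟩ := exists_mul_algebraMap_prod_pow_eq x z
  obtain ⟨r', hr', h'⟩ := exists_coeff_gradedCoaction 𝒜 (CechLoc x I) r
    (m + N * ∑ j ∈ I, (e j : ℤ))
  exact ⟨N, r', hr', by rw [cechLocProj_mul 𝒜 x e hx m h, h']⟩

theorem sum_coeff_gradedCoaction (S : Type*) [CommRing S] [Algebra R S] (r : R) :
    AddMonoidAlgebra.lift S S ℤ 1 (gradedCoaction 𝒜 S r) = algebraMap R S r := by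
  induction r using DirectSum.Decomposition.inductionOn 𝒜 with
  | zero => simp
  | @homogeneous d r =>
    rw [gradedCoaction_of_mem 𝒜 S r.2, AddMonoidAlgebra.lift_single]
    simp
  | add r r' h h' => rw [map_add, map_add, h, h', map_add]

theorem sum_cechLocProj {I : Finset (Fin s)} (z : CechLoc x I) {D : Finset ℤ}
    (hD : (cechLocCoaction 𝒜 x e hx I z).coeff.support ⊆ D) :
    ∑ m ∈ D, cechLocProj 𝒜 x e hx I m z = z := by
  -- Evaluation at `T = 1` adds up the coefficients and undoes the coaction.
  have h1 : AddMonoidAlgebra.lift (CechLoc x I) (CechLoc x I) ℤ 1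
      (cechLocCoaction 𝒜 x e hx I z) = z := by
    obtain ⟨N, r, h⟩ := exists_mul_algebraMap_prod_pow_eq x z
    apply (isUnit_algebraMap_prod_pow x I N).mul_left_injective
    have h2 := congrArg (AddMonoidAlgebra.lift (CechLoc x I) (CechLoc x I) ℤ 1)
      (cechLocCoaction_mul_single 𝒜 x e hx h)
    rw [map_mul, sum_coeff_gradedCoaction, AddMonoidAlgebra.lift_single] at h2
    simp only [MonoidHom.one_apply, smul_eq_mul, mul_one] at h2
    exact h2.trans h.symm
  refine Eq.trans ?_ h1
  rw [AddMonoidAlgebra.lift_apply, Finsupp.sum_of_support_subset _ hD _ (by simp)]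
  exact Finset.sum_congr rfl fun m _ => by simp [cechLocProj]

theorem cechLocProj_eq_zero {I : Finset (Fin s)} {z : CechLoc x I} {D : Finset ℤ}
    (hD : (cechLocCoaction 𝒜 x e hx I z).coeff.support ⊆ D) {m : ℤ} (hm : m ∉ D) :
    cechLocProj 𝒜 x e hx I m z = 0 :=
  Finsupp.notMem_support_iff.mp fun h => hm (hD h)

theorem cechRes_mem_cechLocPiece {I J : Finset (Fin s)} (hIJ : I ⊆ J) {m : ℤ} {z : CechLoc x I}
    (hz : z ∈ cechLocPiece 𝒜 x e hx I m) : cechRes x hIJ z ∈ cechLocPiece 𝒜 x e hx J m := by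
  obtain ⟨N, r, hr, h⟩ := hz
  refine ⟨N, r * (∏ j ∈ J \ I, x j) ^ N, ?_, ?_⟩
  · convert mul_mem_intPiece 𝒜 hr (prod_pow_mem 𝒜 x e hx (J \ I) N) using 2
    rw [← Finset.sum_sdiff hIJ]
    push_cast
    ring
  · have h1 := congrArg (cechRes x hIJ) h
    rw [map_mul, AlgHom.commutes, AlgHom.commutes] at h1
    have h2 : (∏ j ∈ J, x j) ^ N = (∏ j ∈ I, x j) ^ N * (∏ j ∈ J \ I, x j) ^ N := by
      rw [← mul_pow, mul_comm, Finset.prod_sdiff hIJ]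
    have h3 : algebraMap R (CechLoc x J) ((∏ j ∈ J, x j) ^ N) =
        algebraMap R (CechLoc x J) ((∏ j ∈ I, x j) ^ N * (∏ j ∈ J \ I, x j) ^ N) :=
      congrArg _ h2
    rw [h3, map_mul, map_mul, ← mul_assoc, h1]

theorem pow_mem_cechLocPiece {I : Finset (Fin s)} (q : ℕ) {m : ℤ} {z : CechLoc x I}
    (hz : z ∈ cechLocPiece 𝒜 x e hx I m) : z ^ q ∈ cechLocPiece 𝒜 x e hx I (q * m) := by
  induction q with
  | zero =>
    refine ⟨0, 1, ?_, by simp⟩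
    simp only [Nat.cast_zero, zero_mul, add_zero]
    exact (SetLike.GradedOne.one_mem : (1 : R) ∈ 𝒜 0)
  | succ q ih =>
    obtain ⟨N, r, hr, h⟩ := ih
    obtain ⟨M, t, ht, h'⟩ := hz
    refine ⟨N + M, r * t, ?_, ?_⟩
    · have : ∀ {a b : ℤ} {r t : R}, r ∈ intPiece 𝒜 a → t ∈ intPiece 𝒜 b →
          r * t ∈ intPiece 𝒜 (a + b) := by
        intro a b r t hr ht
        cases b with
        | ofNat b => exact mul_mem_intPiece 𝒜 hr ht
        | negSucc b =>
          have h0 : t = 0 := ht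
          rw [h0, mul_zero]; exact zero_mem _
      convert this hr ht using 2
      push_cast
      ring
    · rw [map_mul, ← h, ← h', pow_succ z, pow_add (∏ j ∈ I, x j), map_mul]
      ring

theorem cechLocProj_cechRes {I J : Finset (Fin s)} (hIJ : I ⊆ J) (m : ℤ) (z : CechLoc x I) :
    cechLocProj 𝒜 x e hx J m (cechRes x hIJ z) = cechRes x hIJ (cechLocProj 𝒜 x e hx I m z) := by
  conv_lhs => rw [← sum_cechLocProj 𝒜 x e hx z (Finset.Subset.refl _), map_sum, map_sum]
  rw [Finset.sum_congr rfl fun m' _ => cechLocProj_of_mem 𝒜 x e hx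
    (cechRes_mem_cechLocPiece 𝒜 x e hx hIJ (cechLocProj_mem 𝒜 x e hx I m' z)),
    Finset.sum_ite_eq']
  split_ifs with h
  · rfl
  · rw [cechLocProj_eq_zero 𝒜 x e hx (Finset.Subset.refl _) h, map_zero]

theorem cechLocProj_pow (p : ℕ) [Fact p.Prime] [CharP R p] {I : Finset (Fin s)} (m : ℤ)
    (z : CechLoc x I) :
    cechLocProj 𝒜 x e hx I (p * m) (z ^ p) = cechLocProj 𝒜 x e hx I m z ^ p := by
  have hp : (p : ℤ) ≠ 0 := Nat.cast_ne_zero.mpr (Fact.out : p.Prime).ne_zero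
  let φ : CechLoc x I →+ CechLoc x I :=
    { toFun := fun z => z ^ p
      map_zero' := zero_pow (Fact.out : p.Prime).ne_zero
      map_add' := cechLoc_add_pow p x }
  change cechLocProj 𝒜 x e hx I (p * m) (φ z) = φ (cechLocProj 𝒜 x e hx I m z)
  conv_lhs => rw [← sum_cechLocProj 𝒜 x e hx z (Finset.Subset.refl _), map_sum, map_sum]
  have hφ : ∀ m' : ℤ, cechLocProj 𝒜 x e hx I (p * m) (φ (cechLocProj 𝒜 x e hx I m' z)) =
      if (p : ℤ) * m' = p * m then φ (cechLocProj 𝒜 x e hx I m' z) else 0 := fun m' =>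
    cechLocProj_of_mem 𝒜 x e hx
      (pow_mem_cechLocPiece 𝒜 x e hx p (cechLocProj_mem 𝒜 x e hx I m' z))
  rw [Finset.sum_congr rfl fun m' _ => hφ m']
  -- The Frobenius is additive and multiplies degrees by `p ≠ 0`, so only the component of degree
  -- `m` reaches degree `p * m`.
  simp only [mul_right_inj' hp]
  rw [Finset.sum_ite_eq']
  split_ifs with h
  · rfl
  · rw [cechLocProj_eq_zero 𝒜 x e hx (Finset.Subset.refl _) h, map_zero]

/-- The projection of Čech cochains onto their degree `m` parts. -/
def cechProj (i : ℕ) (m : ℤ) : CechCochain x i →+ CechCochain x i where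
  toFun c I := cechLocProj 𝒜 x e hx I.1 m (c I)
  map_zero' := by funext I; exact map_zero _
  map_add' c c' := by funext I; exact map_add _ _ _

theorem cechD_cechProj (i : ℕ) (m : ℤ) (c : CechCochain x i) :
    cechD x i (cechProj 𝒜 x e hx i m c) = cechProj 𝒜 x e hx (i + 1) m (cechD x i c) := by
  funext J
  change _ = cechLocProj 𝒜 x e hx J.1 m (cechD x i c J)
  rw [cechD_apply, cechD_apply, map_sum]
  refine Finset.sum_congr rfl fun a _ => ?_
  rw [map_zsmul, cechLocProj_cechRes]
  rfl

theorem cechProj_mem_ker {i : ℕ} (m : ℤ) {c : CechCochain x i}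
    (hc : c ∈ LinearMap.ker (cechD x i)) :
    cechProj 𝒜 x e hx i m c ∈ LinearMap.ker (cechD x i) := by
  rw [LinearMap.mem_ker] at hc ⊢
  rw [cechD_cechProj, hc, map_zero]

theorem cechProj_mem_cechCoboundaries {i : ℕ} (m : ℤ) {c : CechCochain x i}
    (hc : c ∈ cechCoboundaries x i) : cechProj 𝒜 x e hx i m c ∈ cechCoboundaries x i := by
  cases i with
  | zero =>
    have h0 : c = 0 := hc
    rw [h0, map_zero]; exact zero_mem _
  | succ i =>
    obtain ⟨b, rfl⟩ := hc
    exact ⟨cechProj 𝒜 x e hx i m b, cechD_cechProj 𝒜 x e hx i m b⟩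

theorem exists_sum_cechProj {i : ℕ} (c : CechCochain x i) :
    ∃ D₀ : Finset ℤ, ∀ D, D₀ ⊆ D → ∑ m ∈ D, cechProj 𝒜 x e hx i m c = c := by
  classical
  let D₁ : {I : Finset (Fin s) // I.card = i} → Finset ℤ := fun I =>
    (cechLocCoaction 𝒜 x e hx I.1 (c I)).coeff.support
  refine ⟨Finset.univ.biUnion D₁, fun D hD => ?_⟩
  funext I
  have hI : D₁ I ⊆ D := (Finset.subset_biUnion_of_mem D₁ (Finset.mem_univ I)).trans hD
  rw [Finset.sum_apply]
  exact sum_cechLocProj 𝒜 x e hx (c I) hI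

theorem mem_cechCohomologyPiece_iff {i : ℕ} {m : ℤ} {z : CechCohomology x i} :
    z ∈ cechCohomologyPiece 𝒜 x e hx i m ↔ ∃ c : LinearMap.ker (cechD x i),
      (∀ I, c.1 I ∈ cechLocPiece 𝒜 x e hx I.1 m) ∧ cechClass x i c = z := by
  rw [cechCohomologyPiece, Submodule.mem_map]
  refine exists_congr fun c => and_congr ?_ Iff.rfl
  rw [Submodule.mem_comap, Submodule.mem_pi]
  exact ⟨fun h I => h I (Set.mem_univ I), fun h I _ => h I⟩

theorem cechClass_cechProj_mem {i : ℕ} (m : ℤ) (c : LinearMap.ker (cechD x i)) :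
    cechClass x i ⟨cechProj 𝒜 x e hx i m c.1, cechProj_mem_ker 𝒜 x e hx m c.2⟩ ∈
      cechCohomologyPiece 𝒜 x e hx i m :=
  (mem_cechCohomologyPiece_iff 𝒜 x e hx).mpr
    ⟨_, fun I => cechLocProj_mem 𝒜 x e hx I.1 m (c.1 I), rfl⟩

/-- The homogeneous components of a class killed by the Frobenius are killed by the Frobenius. -/
theorem cechFrobenius_cechClass_cechProj (p : ℕ) [Fact p.Prime] [CharP R p] {i : ℕ}
    {c : LinearMap.ker (cechD x i)} (hc : cechFrobenius p x i (cechClass x i c) = 0) (m : ℤ) :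
    cechFrobenius p x i
      (cechClass x i ⟨cechProj 𝒜 x e hx i m c.1, cechProj_mem_ker 𝒜 x e hx m c.2⟩) = 0 := by
  rw [cechFrobenius_cechClass, cechClass_eq_zero_iff] at hc ⊢
  have : cechFrobeniusCochain p x i (cechProj 𝒜 x e hx i m c.1) =
      cechProj 𝒜 x e hx i (p * m) (cechFrobeniusCochain p x i c.1) := by
    funext I
    exact (cechLocProj_pow 𝒜 x e hx p m (c.1 I)).symm
  change cechFrobeniusCochain p x i (cechProj 𝒜 x e hx i m c.1) ∈ _
  rw [this]
  exact cechProj_mem_cechCoboundaries 𝒜 x e hx _ hc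

theorem smul_mem_cechCohomologyPiece {i : ℕ} {m : ℤ} {z : CechCohomology x i}
    (hz : z ∈ cechCohomologyPiece 𝒜 x e hx i m) {d : ℕ} {a : R} (ha : a ∈ 𝒜 d) :
    a • z ∈ cechCohomologyPiece 𝒜 x e hx i (m + d) := by
  rw [mem_cechCohomologyPiece_iff] at hz ⊢
  obtain ⟨c, hc, rfl⟩ := hz
  refine ⟨a • c, fun I => ?_, map_smul _ _ _⟩
  obtain ⟨N, r, hr, h⟩ := hc I
  refine ⟨N, r * a, ?_, ?_⟩
  · convert mul_mem_intPiece 𝒜 hr ha using 2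
    ring
  · change a • c.1 I * _ = _
    rw [smul_mul_assoc, h, Algebra.smul_def, mul_comm, map_mul]

end Projection

/-! ### The cohomology of the Veronese subring as the part of degrees divisible by `n`. -/

section VeroneseComparison

variable {k : Type*} [Field k] {R : Type*} [CommRing R] [Algebra k R] (𝒜 : ℕ → Submodule k R)
  [GradedAlgebra 𝒜] {s : ℕ} (x : Fin s → R) (e : Fin s → ℕ) (hx : ∀ j, x j ∈ 𝒜 (e j)) (n : ℕ)

theorem mem_veronese_of_mem {d : ℕ} (hd : n ∣ d) {r : R} (hr : r ∈ 𝒜 d) : r ∈ veronese 𝒜 n := by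
  obtain ⟨t, rfl⟩ := hd
  exact (Submodule.mem_iSup_of_mem t hr : r ∈ ⨆ t : ℕ, 𝒜 (n * t))

theorem mem_veronese_of_mem_intPiece {m : ℤ} (hm : (n : ℤ) ∣ m) {r : R} (hr : r ∈ intPiece 𝒜 m) :
    r ∈ veronese 𝒜 n := by
  cases m with
  | ofNat d => exact mem_veronese_of_mem 𝒜 n (Int.natCast_dvd_natCast.mp hm) hr
  | negSucc d =>
    have h0 : r = 0 := hr
    rw [h0]; exact zero_mem _

/-- The inclusion of the Veronese subring. -/
abbrev veroneseVal : veronese 𝒜 n →+* R := (veronese 𝒜 n).val.toRingHom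

theorem veroneseVal_injective : Function.Injective (veroneseVal 𝒜 n) := Subtype.val_injective

/-- The sequence of the elements `x_j ^ n`, in the Veronese subring. -/
def veroneseSeq (hx : ∀ j, x j ∈ 𝒜 (e j)) (j : Fin s) : veronese 𝒜 n :=
  ⟨x j ^ n, mem_veronese_of_mem 𝒜 n (Dvd.intro _ rfl) (SetLike.pow_mem_graded n (hx j))⟩

theorem veroneseVal_veroneseSeq (hx : ∀ j, x j ∈ 𝒜 (e j)) (j : Fin s) :
    veroneseVal 𝒜 n (veroneseSeq 𝒜 x e n hx j) = x j ^ n := rfl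

/-- The map from the Čech cohomology of the Veronese subring to that of the ring. -/
abbrev veroneseCohMap (i : ℕ) :
    CechCohomology (veroneseSeq 𝒜 x e n hx) i →ₛₗ[veroneseVal 𝒜 n] CechCohomology x i :=
  cechCohomologyRingMap (veroneseVal 𝒜 n) (veroneseVal_veroneseSeq 𝒜 x e n hx) i

theorem cechLocProj_cechLocMap_eq_zero {I : Finset (Fin s)} {m : ℤ} (hm : ¬ (n : ℤ) ∣ m)
    (z : CechLoc (veroneseSeq 𝒜 x e n hx) I) :
    cechLocProj 𝒜 x e hx I m
      (cechLocMap (veroneseVal 𝒜 n) (veroneseVal_veroneseSeq 𝒜 x e n hx) I z) = 0 := by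
  obtain ⟨N, a, ha⟩ := exists_mul_algebraMap_prod_pow_eq _ z
  have h1 := cechLocProj_mul 𝒜 x e hx m
    (cechLocMap_mul_algebraMap_prod_pow _ (veroneseVal_veroneseSeq 𝒜 x e n hx) ha)
  have ha' : veroneseVal 𝒜 n a ∈ veronese 𝒜 n := a.2
  rw [coeff_gradedCoaction_of_mem_veronese 𝒜 _ ha'] at h1
  · apply (isUnit_algebraMap_prod_pow x I (n * N)).mul_left_injective
    simp only [zero_mul]
    exact h1
  · rwa [Int.dvd_add_left]
    push_cast
    rw [mul_assoc]
    exact Dvd.intro _ rfl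

theorem exists_cechLocMap_eq {I : Finset (Fin s)} {m : ℤ} (hn : 0 < n) (hm : (n : ℤ) ∣ m)
    {z : CechLoc x I} (hz : z ∈ cechLocPiece 𝒜 x e hx I m) :
    ∃ z', cechLocMap (veroneseVal 𝒜 n) (veroneseVal_veroneseSeq 𝒜 x e n hx) I z' = z := by
  obtain ⟨N, r, hr, h⟩ := hz
  obtain ⟨n, rfl⟩ := Nat.exists_eq_succ_of_ne_zero hn.ne'
  -- Here `n` is the predecessor of the Veronese order. The fraction `r / x_I ^ N` is expanded to
  -- the denominator `x_I ^ ((n + 1) N)`, a power of the product of the Veronese sequence; the new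
  -- numerator then has degree divisible by `n + 1`.
  have hr' : r * (∏ j ∈ I, x j) ^ (n * N) ∈
      intPiece 𝒜 (m + (n.succ : ℤ) * (N * ∑ j ∈ I, (e j : ℤ))) := by
    convert mul_mem_intPiece 𝒜 hr (prod_pow_mem 𝒜 x e hx I (n * N)) using 2
    push_cast
    ring
  have hv := mem_veronese_of_mem_intPiece 𝒜 n.succ (dvd_add hm (Dvd.intro _ rfl)) hr'
  obtain ⟨z', hz'⟩ := exists_mul_algebraMap_prod_pow_eq' (veroneseSeq 𝒜 x e n.succ hx) I N ⟨_, hv⟩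
  refine ⟨z', ?_⟩
  have h1 := cechLocMap_mul_algebraMap_prod_pow _ (veroneseVal_veroneseSeq 𝒜 x e n.succ hx) hz'
  apply (isUnit_algebraMap_prod_pow x I (n.succ * N)).mul_left_injective
  simp only
  rw [h1]
  have h2 : (∏ j ∈ I, x j) ^ (n.succ * N) =
      (∏ j ∈ I, x j) ^ N * (∏ j ∈ I, x j) ^ (n * N) := by
    rw [← pow_add]; congr 1; rw [Nat.succ_mul, add_comm]
  rw [congrArg (algebraMap R (CechLoc x I)) h2, map_mul, ← mul_assoc, h, ← map_mul]
  rfl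

theorem exists_cechCochainMap_eq {i : ℕ} {m : ℤ} (hn : 0 < n) (hm : (n : ℤ) ∣ m)
    {c : CechCochain x i} (hc : ∀ I, c I ∈ cechLocPiece 𝒜 x e hx I.1 m) :
    ∃ c', cechCochainMap (veroneseVal 𝒜 n) (veroneseVal_veroneseSeq 𝒜 x e n hx) i c' = c := by
  choose c' hc' using fun I => exists_cechLocMap_eq 𝒜 x e hx n hn hm (hc I)
  exact ⟨c', funext hc'⟩

theorem cechProj_cechCochainMap_eq_zero {i : ℕ} {m : ℤ} (hm : ¬ (n : ℤ) ∣ m)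
    (c : CechCochain (veroneseSeq 𝒜 x e n hx) i) :
    cechProj 𝒜 x e hx i m
      (cechCochainMap (veroneseVal 𝒜 n) (veroneseVal_veroneseSeq 𝒜 x e n hx) i c) = 0 :=
  funext fun I => cechLocProj_cechLocMap_eq_zero 𝒜 x e hx n hm (c I)

/-- The Čech complex of the Veronese subring is a direct summand, consisting of the degrees
divisible by `n`. A primitive over `R` can therefore be replaced by its components in those degrees,
which come from the subring. -/
theorem veroneseCohMap_injective (hn : 0 < n) (i : ℕ) :
    Function.Injective (veroneseCohMap 𝒜 x e hx n i) := by
  have hinj := cechCochainMap_injective (veroneseVal 𝒜 n) (veroneseVal_veroneseSeq 𝒜 x e n hx)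
    hn.ne' (veroneseVal_injective 𝒜 n)
  rw [injective_iff_map_eq_zero]
  intro z hz
  obtain ⟨⟨c, hc⟩, rfl⟩ := cechClass_surjective i z
  rw [cechCohomologyMap_cechClass, cechClass_eq_zero_iff] at hz
  rw [cechClass_eq_zero_iff]
  cases i with
  | zero => exact hinj 0 (Eq.trans hz (map_zero _).symm)
  | succ i =>
    obtain ⟨a, ha⟩ := hz
    have hb : ∀ m : ℤ, ∃ b, cechCochainMap (veroneseVal 𝒜 n)
        (veroneseVal_veroneseSeq 𝒜 x e n hx) (i + 1) (cechD _ i b) =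
          cechProj 𝒜 x e hx (i + 1) m (cechCochainMap (veroneseVal 𝒜 n)
            (veroneseVal_veroneseSeq 𝒜 x e n hx) (i + 1) c) := by
      intro m
      by_cases hm : (n : ℤ) ∣ m
      · obtain ⟨b, hb⟩ := exists_cechCochainMap_eq 𝒜 x e hx n hn hm
          (c := cechProj 𝒜 x e hx i m a) (fun I => cechLocProj_mem 𝒜 x e hx I.1 m (a I))
        exact ⟨b, by rw [← cechD_cechCochainMap, hb, cechD_cechProj, ha]⟩
      · exact ⟨0, by rw [map_zero, map_zero, cechProj_cechCochainMap_eq_zero 𝒜 x e hx n hm]⟩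
    choose b hb using hb
    obtain ⟨D, hD⟩ := exists_sum_cechProj 𝒜 x e hx (cechCochainMap (veroneseVal 𝒜 n)
      (veroneseVal_veroneseSeq 𝒜 x e n hx) (i + 1) c)
    refine ⟨∑ m ∈ D, b m, hinj (i + 1) ?_⟩
    rw [map_sum, map_sum, Finset.sum_congr rfl fun m _ => hb m, hD D (Finset.Subset.refl D)]

theorem exists_veroneseCohMap_eq (hn : 0 < n) {i : ℕ} {m : ℤ} (hm : (n : ℤ) ∣ m)
    {z : CechCohomology x i} (hz : z ∈ cechCohomologyPiece 𝒜 x e hx i m) :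
    ∃ y, veroneseCohMap 𝒜 x e hx n i y = z := by
  have hinj := cechCochainMap_injective (veroneseVal 𝒜 n) (veroneseVal_veroneseSeq 𝒜 x e n hx)
    hn.ne' (veroneseVal_injective 𝒜 n)
  obtain ⟨⟨c, hc⟩, hcm, rfl⟩ := (mem_cechCohomologyPiece_iff 𝒜 x e hx).mp hz
  obtain ⟨c', rfl⟩ := exists_cechCochainMap_eq 𝒜 x e hx n hn hm hcm
  refine ⟨cechClass _ i ⟨c', ?_⟩, rfl⟩
  rw [LinearMap.mem_ker, cechD_cechCochainMap] at hc
  exact hinj (i + 1) (hc.trans (map_zero _).symm)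

/-- If the Frobenius is injective in the degrees divisible by `n`, it is injective on the Čech
cohomology of the `n`-th Veronese subring. -/
theorem cechFrobenius_veronese_injective (p : ℕ) [Fact p.Prime] [CharP R p] (hn : 0 < n) (i : ℕ)
    (hF : ∀ m : ℤ, (n : ℤ) ∣ m →
      Set.InjOn (cechFrobenius p x i) (cechCohomologyPiece 𝒜 x e hx i m)) :
    Function.Injective (cechFrobenius p (veroneseSeq 𝒜 x e n hx) i) := by
  rw [injective_iff_map_eq_zero]
  intro z hz
  apply veroneseCohMap_injective 𝒜 x e hx n hn i
  have h0 := cechCohomologyMap_cechFrobenius _ (cechD_cechCochainMap _ _) p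
    (cechCochainMap_cechFrobeniusCochain _ (veroneseVal_veroneseSeq 𝒜 x e n hx) p) i z
  rw [hz, map_zero] at h0
  rw [map_zero]
  obtain ⟨⟨c, hc⟩, rfl⟩ := cechClass_surjective i z
  rw [cechCohomologyMap_cechClass] at h0 ⊢
  obtain ⟨D, hD⟩ := exists_sum_cechProj 𝒜 x e hx (cechCochainMap (veroneseVal 𝒜 n)
    (veroneseVal_veroneseSeq 𝒜 x e n hx) i c)
  rw [cechClass_eq_zero_iff]
  change cechCochainMap (veroneseVal 𝒜 n) (veroneseVal_veroneseSeq 𝒜 x e n hx) i c ∈ _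
  rw [← hD D (Finset.Subset.refl D)]
  refine sum_mem fun m _ => ?_
  by_cases hm : (n : ℤ) ∣ m
  -- The components of a class killed by `F` are killed by `F`, so injectivity degree by degree
  -- suffices.
  · have h1 := hF m hm (cechClass_cechProj_mem 𝒜 x e hx m _) (zero_mem _)
      ((cechFrobenius_cechClass_cechProj 𝒜 x e hx p h0.symm m).trans (map_zero _).symm)
    rwa [cechClass_eq_zero_iff] at h1
  · rw [cechProj_cechCochainMap_eq_zero 𝒜 x e hx n hm]
    exact zero_mem _

/-- If the Čech cohomology vanishes in the positive degrees divisible by `n`, the Veronese subring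
acts on the degree zero part through its constants. -/
theorem smul_eq_projZero_smul {i : ℕ}
    (hvanish : ∀ t : ℕ, 0 < t → cechCohomologyPiece 𝒜 x e hx i ((t * n : ℕ) : ℤ) = ⊥)
    {a : R} (ha : a ∈ veronese 𝒜 n) {v : CechCohomology x i}
    (hv : v ∈ cechCohomologyPiece 𝒜 x e hx i 0) (hn : 0 < n) :
    a • v = GradedRing.projZeroRingHom 𝒜 a • v := by
  have ha' : a ∈ ⨆ t : ℕ, 𝒜 (n * t) := ha
  clear ha
  induction ha' using Submodule.iSup_induction' with
  | mem t a hat =>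
    rw [GradedRing.projZeroRingHom_apply]
    rcases Nat.eq_zero_or_pos t with rfl | ht
    · rw [DirectSum.decompose_of_mem_same 𝒜 (by rwa [mul_zero] at hat)]
    · have h1 := smul_mem_cechCohomologyPiece 𝒜 x e hx hv hat
      rw [zero_add, mul_comm n t, hvanish t ht, Submodule.mem_bot] at h1
      rw [DirectSum.decompose_of_mem_ne 𝒜 hat (Nat.mul_pos hn ht).ne', h1, zero_smul]
  | zero => rw [map_zero]
  | add a b _ _ iha ihb => rw [map_add, add_smul, add_smul, iha, ihb]

/-- A power of `a` lies in the extension to `R` of the ideal of the `x_j ^ n`. Ideals of the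
Veronese subring are contracted from `R` by `comap_map_veronese`, so that power lies in the ideal
itself. -/
theorem mem_radical_span_veroneseSeq
    (hrad : (Ideal.span (Set.range x)).radical = (HomogeneousIdeal.irrelevant 𝒜).toIdeal)
    {a : veronese 𝒜 n} (ha : a ∈ veroneseIrrelevant 𝒜 n) :
    a ∈ (Ideal.span (Set.range (veroneseSeq 𝒜 x e n hx))).radical := by
  have ha' : (a : R) ∈ (Ideal.span (Set.range x)).radical := hrad.ge ha
  have hle : Ideal.span (Set.range x) ≤
      ((Ideal.span (Set.range (veroneseSeq 𝒜 x e n hx))).map (veronese 𝒜 n).val).radical := by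
    rw [Ideal.span_le]
    rintro _ ⟨j, rfl⟩
    exact Ideal.mem_radical_iff.mpr
      ⟨n, Ideal.mem_map_of_mem (veronese 𝒜 n).val (Ideal.subset_span (Set.mem_range_self j))⟩
  have h1 := Ideal.radical_mono hle ha'
  rw [Ideal.radical_idem] at h1
  obtain ⟨N, hN⟩ := h1
  refine ⟨N, ?_⟩
  rw [← comap_map_veronese 𝒜 n (Ideal.span _), Ideal.mem_comap, map_pow]
  exact hN

theorem veroneseSeq_mem_veroneseIrrelevant
    (hrad : (Ideal.span (Set.range x)).radical = (HomogeneousIdeal.irrelevant 𝒜).toIdeal)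
    (hn : 0 < n) (j : Fin s) : veroneseSeq 𝒜 x e n hx j ∈ veroneseIrrelevant 𝒜 n := by
  change x j ^ n ∈ (HomogeneousIdeal.irrelevant 𝒜).toIdeal
  rw [← hrad]
  exact Ideal.pow_mem_of_mem _ (Ideal.le_radical (Ideal.subset_span (Set.mem_range_self j))) n hn

end VeroneseComparison

/-! ### Frobenius and stable submodules under localization. -/

section LocalizationFrobenius

variable (p : ℕ) [Fact p.Prime] {A : Type*} [CommRing A] [CharP A p] {s : ℕ}
  {x : Fin s → A}

theorem cechCohomologyRingMap_cechFrobenius {A' : Type*} [CommRing A'] [CharP A' p] (φ : A →+* A')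
    {x' : Fin s → A'} {m : ℕ} (h : ∀ j, φ (x j) = x' j ^ m) (i : ℕ) (z : CechCohomology x i) :
    cechCohomologyRingMap φ h i (cechFrobenius p x i z) =
      cechFrobenius p x' i (cechCohomologyRingMap φ h i z) :=
  cechCohomologyMap_cechFrobenius _ (cechD_cechCochainMap φ h) p
    (cechCochainMap_cechFrobeniusCochain φ h p) i z

/-- Injectivity of the Frobenius on Čech cohomology passes to localizations. -/
theorem cechFrobenius_injective_of_isLocalization (M : Submonoid A) (A' : Type*) [CommRing A']
    [CharP A' p] [Algebra A A'] [IsLocalization M A'] {x' : Fin s → A'}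
    (h : ∀ j, algebraMap A A' (x j) = x' j ^ 1)
    {i : ℕ} (hF : Function.Injective (cechFrobenius p x i)) :
    Function.Injective (cechFrobenius p x' i) := by
  rw [injective_iff_map_eq_zero]
  intro ξ hξ
  obtain ⟨u, hu, y, hy⟩ := exists_smul_eq_cechCohomologyRingMap M A' h ξ
  have h1 : cechCohomologyRingMap (algebraMap A A') h i (cechFrobenius p x i y) = 0 := by
    rw [cechCohomologyRingMap_cechFrobenius, ← hy, map_smulₛₗ, hξ, smul_zero]
  obtain ⟨v, hv, hvy⟩ := exists_smul_eq_zero_of_cechCohomologyRingMap M A' h h1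
  -- From `v • F y = 0` follows `F (v • y) = v ^ p • F y = 0`, and injectivity applies.
  have h2 : v • y = 0 := by
    apply hF
    obtain ⟨q, hq⟩ := Nat.exists_eq_succ_of_ne_zero (Fact.out : p.Prime).ne_zero
    have hvp : v ^ p = v ^ q * v := by rw [← pow_succ]; exact congrArg _ hq
    rw [map_zero, map_smulₛₗ, frobenius_def, hvp, mul_smul, hvy, smul_zero]
  have h3 := congrArg (cechCohomologyRingMap (algebraMap A A') h i) h2
  rw [map_smulₛₗ, map_zero, ← hy] at h3
  have hunit := fun w hw => IsLocalization.map_units A' (⟨w, hw⟩ : M)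
  exact (hunit u hu).smul_eq_zero.mp ((hunit v hv).smul_eq_zero.mp h3)

/-- A Frobenius stable submodule of Čech cohomology whose quotient has a nonzero nilpotent
class not killed by the localization gives such a submodule over the localization. -/
theorem exists_submodule_of_isLocalization (M : Submonoid A) (A' : Type*) [CommRing A']
    [CharP A' p] [Algebra A A'] [IsLocalization M A'] {x' : Fin s → A'}
    (h : ∀ j, algebraMap A A' (x j) = x' j ^ 1) {i : ℕ}
    (N : Submodule A (CechCohomology x i)) (hN : ∀ z ∈ N, cechFrobenius p x i z ∈ N)
    {y₀ : CechCohomology x i} (hy₀ : ∀ u ∈ M, u • y₀ ∉ N) (hFy₀ : cechFrobenius p x i y₀ ∈ N) :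
    ∃ N' : Submodule A' (CechCohomology x' i), (∀ z ∈ N', cechFrobenius p x' i z ∈ N') ∧
      ∃ ξ, ξ ∉ N' ∧ cechFrobenius p x' i ξ ∈ N' := by
  -- This is the localization of `N`, described by clearing denominators.
  let N' : Submodule A' (CechCohomology x' i) :=
    { carrier := {ξ | ∃ u ∈ M, ∃ y ∈ N,
        algebraMap A A' u • ξ = cechCohomologyRingMap (algebraMap A A') h i y}
      zero_mem' := ⟨1, M.one_mem, 0, zero_mem _, by rw [smul_zero, map_zero]⟩
      add_mem' := by
        rintro ξ ξ' ⟨u, hu, y, hy, h⟩ ⟨u', hu', y', hy', h'⟩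
        refine ⟨u' * u, M.mul_mem hu' hu, u' • y + u • y',
          add_mem (N.smul_mem _ hy) (N.smul_mem _ hy'), ?_⟩
        rw [map_add, map_smulₛₗ, map_smulₛₗ, ← h, ← h', smul_smul, smul_smul, ← map_mul,
          ← map_mul, mul_comm u u', smul_add]
      smul_mem' := by
        rintro b ξ ⟨u, hu, y, hy, h⟩
        obtain ⟨⟨a, w⟩, haw⟩ := IsLocalization.surj M b
        refine ⟨w * u, M.mul_mem w.2 hu, a • y, N.smul_mem _ hy, ?_⟩
        rw [map_smulₛₗ, ← h, smul_smul, smul_smul, ← haw, map_mul]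
        congr 1
        ring }
  refine ⟨N', ?_, cechCohomologyRingMap (algebraMap A A') h i y₀, ?_, ?_⟩
  · rintro z ⟨u, hu, y, hy, hz⟩
    refine ⟨u ^ p, M.pow_mem hu p, cechFrobenius p x i y, hN y hy, ?_⟩
    rw [cechCohomologyRingMap_cechFrobenius, ← hz, map_smulₛₗ, frobenius_def, map_pow]
  · rintro ⟨u, hu, y, hy, hz⟩
    have h1 : cechCohomologyRingMap (algebraMap A A') h i (u • y₀ - y) = 0 := by
      rw [map_sub, map_smulₛₗ, hz, sub_self]
    obtain ⟨w, hw, hwy⟩ := exists_smul_eq_zero_of_cechCohomologyRingMap M A' h h1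
    rw [smul_sub, sub_eq_zero, smul_smul] at hwy
    exact hy₀ (w * u) (M.mul_mem hw hu) (hwy ▸ N.smul_mem w hy)
  · exact ⟨1, M.one_mem, _, hFy₀, by
      rw [cechCohomologyRingMap_cechFrobenius, map_one, one_smul]⟩

end LocalizationFrobenius

/-! ### Transfer to the definitions for local rings. -/

section LocalRing

variable (p : ℕ) [Fact p.Prime] {A : Type*} [CommRing A] [CharP A p] [IsNoetherianRing A]
  [IsLocalRing A] {s : ℕ} {x : Fin s → A}

theorem exists_localCoh_equiv
    (hx : (Ideal.span (Set.range x)).radical = IsLocalRing.maximalIdeal A) (i : ℕ) :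
    ∃ E : LocalCoh A i ≃ₗ[A] CechCohomology x i,
      ∀ z, E (localCohFrobenius p A i z) = cechFrobenius p x i (E z) := by
  have hg := span_idealGens (IsLocalRing.maximalIdeal A)
  refine exists_cechCohomology_equiv p (fun j => ?_) (fun j => ?_) i
  · rw [hx]
    exact hg.le (Ideal.subset_span (Set.mem_range_self j))
  · rw [hg]
    exact Ideal.le_radical (hx.le (Ideal.le_radical (Ideal.subset_span (Set.mem_range_self j))))

theorem isFInjective_of_radical_eq
    (hx : (Ideal.span (Set.range x)).radical = IsLocalRing.maximalIdeal A)
    (hF : ∀ i, Function.Injective (cechFrobenius p x i)) : IsFInjective p A := by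
  intro i _ z z' hz
  obtain ⟨E, hE⟩ := exists_localCoh_equiv p hx i
  apply E.injective
  apply hF i
  rw [← hE, ← hE, hz]

theorem not_isFAntiNilpotent_of_radical_eq
    (hx : (Ideal.span (Set.range x)).radical = IsLocalRing.maximalIdeal A) {i : ℕ}
    (N : Submodule A (CechCohomology x i)) (hN : ∀ z ∈ N, cechFrobenius p x i z ∈ N)
    {ξ : CechCohomology x i} (hξ : ξ ∉ N) (hFξ : cechFrobenius p x i ξ ∈ N) :
    ¬ IsFAntiNilpotent p A := by
  intro hanti
  obtain ⟨E, hE⟩ := exists_localCoh_equiv p hx i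
  rcases le_or_gt (i : WithBot ℕ∞) (ringKrullDim A) with hi | hi
  · obtain ⟨z, rfl⟩ := E.surjective ξ
    have hN' : N.comap E.toLinearMap ≤
        (N.comap E.toLinearMap).comap (localCohFrobenius p A i) := by
      intro z hz
      change E (localCohFrobenius p A i z) ∈ N
      rw [hE]
      exact hN _ hz
    apply hξ
    change z ∈ N.comap E.toLinearMap
    rw [← Submodule.Quotient.mk_eq_zero]
    apply hanti i hi _ hN'
    rw [map_zero]
    refine (Submodule.Quotient.mk_eq_zero _).mpr ?_
    change E (localCohFrobenius p A i z) ∈ N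
    rw [hE]
    exact hFξ
  -- The definition says nothing in degrees above the dimension, but there the cohomology is zero
  -- and cannot contain `ξ ∉ N`.
  · have := subsingleton_localCoh p hi
    have h0 : ξ = 0 := by
      rw [← E.apply_symm_apply ξ, Subsingleton.elim (E.symm ξ) 0, map_zero]
    exact hξ (h0 ▸ zero_mem N)

end LocalRing

/-! ### The localized Veronese subring and the submodule defined by `V`. -/

section VeroneseLocalization

variable {k : Type*} [Field k] (p : ℕ) [Fact p.Prime] {R : Type*} [CommRing R] [Algebra k R]
  (𝒜 : ℕ → Submodule k R) [GradedAlgebra 𝒜] [IsConnectedGrading 𝒜] {s : ℕ} (x : Fin s → R)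
  (e : Fin s → ℕ) (hx : ∀ j, x j ∈ 𝒜 (e j)) (n : ℕ)

theorem radical_span_algebraMap_veroneseSeq
    (hrad : (Ideal.span (Set.range x)).radical = (HomogeneousIdeal.irrelevant 𝒜).toIdeal)
    (hn : 0 < n) :
    (Ideal.span (Set.range (algebraMap (veronese 𝒜 n)
      (Localization.AtPrime (veroneseIrrelevant 𝒜 n)) ∘ veroneseSeq 𝒜 x e n hx))).radical =
        IsLocalRing.maximalIdeal (Localization.AtPrime (veroneseIrrelevant 𝒜 n)) := by
  rw [Set.range_comp, ← Ideal.map_span, ← Localization.AtPrime.map_eq_maximalIdeal]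
  apply le_antisymm
  · rw [Localization.AtPrime.map_eq_maximalIdeal]
    apply (Ideal.radical_mono _).trans (IsLocalRing.maximalIdeal.isMaximal _).isPrime.radical.le
    rw [← Localization.AtPrime.map_eq_maximalIdeal]
    refine Ideal.map_mono (Ideal.span_le.mpr ?_)
    rintro _ ⟨j, rfl⟩
    exact veroneseSeq_mem_veroneseIrrelevant 𝒜 x e hx n hrad hn j
  · rw [Ideal.map_le_iff_le_comap]
    intro a ha
    obtain ⟨N, hN⟩ := Ideal.mem_radical_iff.mp (mem_radical_span_veroneseSeq 𝒜 x e hx n hrad ha)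
    refine Ideal.mem_radical_iff.mpr ⟨N, ?_⟩
    rw [← map_pow]
    exact Ideal.mem_map_of_mem _ hN

/-- The Veronese subring acts on a graded component through its constants, if the components in
which positive degree elements map it vanish. -/
theorem exists_veronese_smul_eq {i : ℕ} (hn : 0 < n)
    (hvanish : ∀ t : ℕ, 0 < t → cechCohomologyPiece 𝒜 x e hx i ((t * n : ℕ) : ℤ) = ⊥)
    (a : veronese 𝒜 n) : ∃ c : k, (c = 0 ↔ a ∈ veroneseIrrelevant 𝒜 n) ∧
      ∀ v ∈ cechCohomologyPiece 𝒜 x e hx i 0, veroneseVal 𝒜 n a • v = c • v := by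
  have h : GradedRing.projZeroRingHom 𝒜 a ∈ 𝒜 0 := by
    rw [GradedRing.projZeroRingHom_apply]; exact SetLike.coe_mem _
  rw [IsConnectedGrading.zero_eq_one (𝒜 := 𝒜)] at h
  obtain ⟨c, hc⟩ := Submodule.mem_one.mp h
  refine ⟨c, ?_, fun v hv => ?_⟩
  · rw [← map_eq_zero_iff (algebraMap k R) (IsConnectedGrading.algebraMap_injective 𝒜), hc]
    exact Iff.rfl
  · rw [← algebraMap_smul R c v, hc]
    exact smul_eq_projZero_smul 𝒜 x e hx n hvanish a.2 hv hn

/-- The submodule is the preimage of `V`; it is stable under the Veronese subring because that ring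
acts on degree zero through `k`. Elements outside the irrelevant ideal act as nonzero scalars, which
gives the strong form of `y ∉ N` needed for localizing. -/
theorem exists_veronese_submodule [CharP R p] (hn : 0 < n) {j : ℕ}
    (hvanish : ∀ t : ℕ, 0 < t → cechCohomologyPiece 𝒜 x e hx j ((t * n : ℕ) : ℤ) = ⊥)
    (V : Submodule k (CechCohomology x j)) (hV : V ≤ cechCohomologyPiece 𝒜 x e hx j 0)
    (hFV : ∀ v ∈ V, cechFrobenius p x j v ∈ V) {η : CechCohomology x j}
    (hη : η ∈ cechCohomologyPiece 𝒜 x e hx j 0) (hηV : η ∉ V) (hFη : cechFrobenius p x j η ∈ V) :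
    ∃ N : Submodule (veronese 𝒜 n) (CechCohomology (veroneseSeq 𝒜 x e n hx) j),
      (∀ z ∈ N, cechFrobenius p _ j z ∈ N) ∧
      ∃ y, (∀ u ∈ (veroneseIrrelevant 𝒜 n).primeCompl, u • y ∉ N) ∧
        cechFrobenius p _ j y ∈ N := by
  have hconst := exists_veronese_smul_eq 𝒜 x e hx n hn hvanish
  let N : Submodule (veronese 𝒜 n) (CechCohomology (veroneseSeq 𝒜 x e n hx) j) :=
    { carrier := {y | veroneseCohMap 𝒜 x e hx n j y ∈ V}
      zero_mem' := by
        change veroneseCohMap 𝒜 x e hx n j 0 ∈ V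
        rw [map_zero]
        exact zero_mem _
      add_mem' := by
        intro y y' hy hy'
        change veroneseCohMap 𝒜 x e hx n j (y + y') ∈ V
        rw [map_add]
        exact add_mem hy hy'
      smul_mem' := by
        intro a y hy
        change veroneseCohMap 𝒜 x e hx n j (a • y) ∈ V
        obtain ⟨c, -, hc⟩ := hconst a
        rw [map_smulₛₗ, hc _ (hV hy)]
        exact V.smul_mem c hy }
  obtain ⟨y, rfl⟩ := exists_veroneseCohMap_eq 𝒜 x e hx n hn (dvd_zero _) hη
  have hF := cechCohomologyRingMap_cechFrobenius p _ (veroneseVal_veroneseSeq 𝒜 x e n hx) j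
  refine ⟨N, fun z hz => ?_, y, fun u hu huy => ?_, ?_⟩
  · change veroneseCohMap 𝒜 x e hx n j _ ∈ V
    rw [hF]
    exact hFV _ hz
  · change veroneseCohMap 𝒜 x e hx n j (u • y) ∈ V at huy
    obtain ⟨c, hc, hcv⟩ := hconst u
    rw [map_smulₛₗ, hcv _ hη] at huy
    exact hηV ((V.smul_mem_iff fun h0 => hu (hc.mp h0)).mp huy)
  · change veroneseCohMap 𝒜 x e hx n j _ ∈ V
    rw [hF]
    exact hFη

end VeroneseLocalization

end

theorem mainTheorem5 {k : Type*} [Field k] (p : ℕ) [Fact p.Prime]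
    {R : Type*} [CommRing R] [Algebra k R] [CharP R p] [IsNoetherianRing R]
    (𝒜 : ℕ → Submodule k R) [GradedAlgebra 𝒜] [IsConnectedGrading 𝒜]
    -- homogeneous elements generating the homogeneous maximal ideal up to radical
    {s : ℕ} (x : Fin s → R) (e : Fin s → ℕ) (hx : ∀ j, x j ∈ 𝒜 (e j))
    (hrad : (Ideal.span (Set.range x)).radical = (HomogeneousIdeal.irrelevant 𝒜).toIdeal)
    -- Frobenius is injective on local cohomology in degrees at most `-n₀`
    (n₀ : ℕ)
    (hneg : ∀ i m : ℕ, n₀ ≤ m →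
      Set.InjOn (cechFrobenius p x i) (cechCohomologyPiece 𝒜 x e hx i (-(m : ℤ))))
    -- Frobenius is injective on local cohomology in degree zero
    (hzero : ∀ i : ℕ, Set.InjOn (cechFrobenius p x i) (cechCohomologyPiece 𝒜 x e hx i 0))
    -- an `F`-stable subspace `V` in degree zero with `F η ∈ V` for some `η ∉ V`
    (hV : ∃ (j : ℕ) (V : Submodule k (CechCohomology x j)),
      V ≤ cechCohomologyPiece 𝒜 x e hx j 0 ∧
      (∀ v ∈ V, cechFrobenius p x j v ∈ V) ∧
      ∃ η ∈ cechCohomologyPiece 𝒜 x e hx j 0, η ∉ V ∧ cechFrobenius p x j η ∈ V)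
    (n : ℕ) (hn : 0 < n) (hn₀ : n₀ ≤ n)
    (hvanish : ∀ i t : ℕ, 0 < t →
      cechCohomologyPiece 𝒜 x e hx i ((t * n : ℕ) : ℤ) = ⊥) :
    IsFInjective p (Localization.AtPrime (veroneseIrrelevant 𝒜 n)) ∧
      ¬ IsFAntiNilpotent p (Localization.AtPrime (veroneseIrrelevant 𝒜 n)) := by
  have hB := radical_span_algebraMap_veroneseSeq 𝒜 x e hx n hrad hn
  constructor
  · refine isFInjective_of_radical_eq p hB fun i =>
      cechFrobenius_injective_of_isLocalization p (veroneseIrrelevant 𝒜 n).primeCompl _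
        (fun j => (pow_one _).symm)
        (cechFrobenius_veronese_injective 𝒜 x e hx n p hn i fun m hm => ?_)
    obtain ⟨t, rfl⟩ := hm
    -- The three signs of `t` use the three hypotheses: for `t < 0` the degree is at most `-n ≤
    -- -n₀`, and for `t > 0` the component is zero.
    rcases lt_trichotomy t 0 with ht | rfl | ht
    · obtain ⟨t, rfl⟩ := Int.exists_eq_neg_ofNat ht.le
      have ht' : 0 < t := by omega
      have h := hneg i (n * t) (hn₀.trans (Nat.le_mul_of_pos_right n ht'))
      rwa [Nat.cast_mul, ← mul_neg] at h
    · rw [mul_zero]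
      exact hzero i
    · lift t to ℕ using ht.le
      have h := hvanish i t (by omega)
      rw [Nat.cast_mul, mul_comm] at h
      rw [h]
      exact Set.injOn_singleton _ _
  · obtain ⟨j, V, hV0, hFV, η, hη, hηV, hFη⟩ := hV
    obtain ⟨N, hN, y, hy, hFy⟩ := exists_veronese_submodule p 𝒜 x e hx n hn (hvanish j) V hV0 hFV
      hη hηV hFη
    obtain ⟨N', hN', ξ, hξ, hFξ⟩ := exists_submodule_of_isLocalization p
      (veroneseIrrelevant 𝒜 n).primeCompl (Localization.AtPrime (veroneseIrrelevant 𝒜 n))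
      (fun j => (pow_one _).symm) N hN hy hFy
    exact not_isFAntiNilpotent_of_radical_eq p hB N' hN' hξ hFξ
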